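/- Let $0<r<R<\infty$ and $\delta\in\mathbb R$. For $\nu\ge 0$ let $J_\nu,Y_\nu$ be the Bessel functions of the first and second kind and put $$\widetilde{\mathfrak h}_{\nu,\delta}(z)=\mathfrak g_\nu(z)+\frac{\delta^2}{Rr z^{2}}\,\mathfrak f_\nu(z)-\frac{\delta}{Rz}\bigl(J_\nu(Rz)Y_\nu'(rz)-J_\nu'(rz)Y_\nu(Rz)\bigr)-\frac{\delta}{rz}\bigl(J_\nu'(Rz)Y_\nu(rz)-J_\nu(rz)Y_\nu'(Rz)\bigr),$$ where $\mathfrak f_\nu(z)=J_\nu(Rz)Y_\nu(rz)-J_\nu(rz)Y_\nu(Rz)$ and $\mathfrak g_\nu(z)=J_\nu'(Rz)Y_\nu'(rz)-J_\nu'(rz)Y_\nu'(Rz)$, with all Bessel functions evaluated on the principal branch and $J_\nu',Y_\nu'$ on the negative real axis understood as boundary values from $\arg z=\pi$. (For $x>0$ one has $\widetilde{\mathfrak h}_{\nu,\delta}(x)=(Rr)^{\delta}x^{2\delta}\bigl(j'(Rx)y'(rx)-j'(rx)y'(Rx)\bigr)$ with $j(x)=x^{-\delta}J_\nu(x)$ and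 $y(x)=x^{-\delta}Y_\nu(x)$.) Then there is a constant $C>0$, depending only on $r,R,\delta$, such that for every $\nu\ge0$ the function $\widetilde{\mathfrak h}_{\nu,\delta}$ is holomorphic in $\mathbb C\setminus\{0\}$ and meromorphic at $0$, and for every natural number $s>C(\nu^3+1)$ the function $\widetilde{\mathfrak h}_{\nu,\delta}$ (with any removable singularity at $0$ removed) has, counted with multiplicity, inside the circle $|z|=(s+\tfrac12)\pi/(R-r)$ exactly $2s+2$ zeros if $\nu\neq|\delta|$, and exactly $2s$ zeros if $\nu=|\delta|$. -/

import Mathlib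

open Filter Topology

noncomputable section

/-- The Bessel function of the first kind `J_ν(z)`, principal branch `-π < arg z ≤ π`:
`(z/2)^ν ∑ (-1)^k / (k! Γ(ν+k+1)) (z/2)^(2k)`. Mathlib's `Γ` vanishes at its poles and `0⁻¹ = 0`,
so that `1/Γ` is given its correct value `0` there. -/
def besselJ (ν z : ℂ) : ℂ :=
  (z / 2) ^ ν *
    ∑' k : ℕ, (-1) ^ k / ((k.factorial : ℂ) * Complex.Gamma (ν + k + 1)) * (z / 2) ^ (2 * k)

/-- The quotient `(J_ν(z) cos νπ - J_{-ν}(z)) / sin νπ`. -/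
def besselYQuot (ν z : ℂ) : ℂ :=
  (besselJ ν z * Complex.cos (ν * Real.pi) - besselJ (-ν) z) / Complex.sin (ν * Real.pi)

open Classical in
/-- The Bessel function of the second kind `Y_ν(z)`, principal branch; for an integer order the
quotient is replaced by its limiting value. -/
def besselY (ν z : ℂ) : ℂ :=
  if ∃ n : ℤ, ν = n then limUnder (𝓝[≠] ν) (fun μ => besselYQuot μ z) else besselYQuot ν z

/-- The derivative of `f` at `w ≠ 0`, taken along the ray through `w`. Where `f` is complex
differentiable this is the usual derivative `f'(w)` (see `rayDeriv_eq_deriv`). For a principal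
branch cut along the negative real axis it has on the cut the boundary value, from
`arg w = π`, of the derivative, in agreement with the convention for `f` itself. -/
def rayDeriv (f : ℂ → ℂ) (w : ℂ) : ℂ :=
  deriv (fun t : ℝ => f (t * w)) 1 / w

theorem rayDeriv_eq_deriv (f : ℂ → ℂ) (w : ℂ) (hw : w ≠ 0) (hf : DifferentiableAt ℂ f w) :
    rayDeriv f w = deriv f w := by
  have h1 : HasDerivAt (fun t : ℝ => (t : ℂ) * w) w 1 := by
    simpa using (Complex.ofRealCLM.hasDerivAt (x := (1 : ℝ))).mul_const w
  have h2 : HasDerivAt f (deriv f w) (((1 : ℝ) : ℂ) * w) := by simpa using hf.hasDerivAt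
  have h3 := h2.comp (1 : ℝ) h1
  unfold rayDeriv
  rw [show (fun t : ℝ => f (t * w)) = f ∘ (fun t : ℝ => (t : ℂ) * w) from rfl, h3.deriv]
  field_simp

/-- `J_ν'(z)`. -/
def besselJ' (ν z : ℂ) : ℂ := rayDeriv (besselJ ν) z

/-- `Y_ν'(z)`. -/
def besselY' (ν z : ℂ) : ℂ := rayDeriv (besselY ν) z

/-- `𝔣_ν(z) = J_ν(Rz) Y_ν(rz) - J_ν(rz) Y_ν(Rz)`. -/
def crossF (r R ν : ℝ) (z : ℂ) : ℂ :=
  besselJ ν (R * z) * besselY ν (r * z) - besselJ ν (r * z) * besselY ν (R * z)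

/-- `𝔤_ν(z) = J_ν'(Rz) Y_ν'(rz) - J_ν'(rz) Y_ν'(Rz)`. -/
def crossG (r R ν : ℝ) (z : ℂ) : ℂ :=
  besselJ' ν (R * z) * besselY' ν (r * z) - besselJ' ν (r * z) * besselY' ν (R * z)

/-- The term `ℰ_{ν,δ}`. -/
def crossE (r R ν δ : ℝ) (z : ℂ) : ℂ :=
  (δ : ℂ) ^ 2 * ((R : ℂ) * r)⁻¹ * (z ^ 2)⁻¹ * crossF r R ν z
    - δ * (R : ℂ)⁻¹ * z⁻¹ *
      (besselJ ν (R * z) * besselY' ν (r * z) - besselJ' ν (r * z) * besselY ν (R * z))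
    - δ * (r : ℂ)⁻¹ * z⁻¹ *
      (besselJ' ν (R * z) * besselY ν (r * z) - besselJ ν (r * z) * besselY' ν (R * z))

/-- The cross-product `𝔥̃_{ν,δ} = 𝔤_ν + ℰ_{ν,δ}`. Its value at `z = 0` is immaterial. -/
def hTilde (r R ν δ : ℝ) (z : ℂ) : ℂ := crossG r R ν z + crossE r R ν δ z

/-- The function `f`, after removal of removable singularities, has exactly `N` zeros in `U`,
counted with multiplicity. -/
def HasZeroCount (f : ℂ → ℂ) (U : Set ℂ) (N : ℕ) : Prop :=
  {z ∈ U | 0 < meromorphicOrderAt f z}.Finite ∧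
    ∑ᶠ z ∈ U, (meromorphicOrderAt f z).untop₀.toNat = N

end

noncomputable section

/-! The function `(π/2) R r z² 𝔥̃(z)` is the endpoint value of an initial value problem. Put `x =
log t`, so that `J_ν(tz)` and `Y_ν(tz)` both solve `u'' = (ν² - z² e^{2x}) u`. Let `u` be the
combination of them with `u(log r) = 1` and `u'(log r) = δ`. Since their Wronskian in `x` is `2/π`,
one finds `(π/2) R r z² 𝔥̃(z) = u'(log R) - δ u(log R)` (`exists_isShooting_crossLog`). The right
side depends on `z` only through `z²` and depends continuously on it down to `z = 0`. Hence it is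
single-valued and extends to an entire function, `crossEntire`, and `𝔥̃` is this function times a
constant and `z⁻²`.

For large `z`, the substitution `w(t) = √(t/r) u(log t)` gives `w'' = ((ν² - 1/4)/t² - z²) w`, a
bounded perturbation of `w'' = -z² w`. Therefore `crossEntire` is close to a constant multiple of `z
sin(z(R-r))` once `|z|` exceeds a multiple of `ν² + 1` (`IsShooting.exists_asymptotic`). On the
circles of the theorem the sine is bounded below by `e^{|Im|}/8`, and Rouché's theorem gives
`crossEntire` as many zeros as the model has, namely `2s + 2`. A threshold quadratic in `ν`
suffices, and the cubic one dominates it.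

It remains to find the order at `0`, which is decided by the problem with `z² = 0`. If `ν ≠ |δ|`,
its endpoint value is nonzero, so `𝔥̃` has a double pole at `0` and keeps all `2s + 2` zeros. If `ν
= |δ|`, the solution is `e^{δ(x - log r)}` and the endpoint value vanishes. A Lagrange identity
(`IsShooting.exists_lower_bound`) shows that it vanishes exactly to first order in `z²`, so the
factor `z⁻²` removes two zeros. -/

/-! ### Argument principle and Rouché's theorem for entire functions on a disc. -/

/-- The number of zeros of `f` in `U`, counted with multiplicity. -/
def zeroCount (f : ℂ → ℂ) (U : Set ℂ) : ℕ := ∑ᶠ z ∈ U, analyticOrderNatAt f z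

theorem analyticOrderAt_ne_top_of_entire {f : ℂ → ℂ} (hf : Differentiable ℂ f) {w : ℂ}
    (hw : f w ≠ 0) (a : ℂ) : analyticOrderAt f a ≠ ⊤ := by
  have hfa : AnalyticOnNhd ℂ f Set.univ := fun z _ => hf.analyticAt z
  refine hfa.analyticOrderAt_ne_top_of_isPreconnected isPreconnected_univ (Set.mem_univ w)
    (Set.mem_univ a) ?_
  rw [(hf.analyticAt w).analyticOrderAt_eq_zero.2 hw]
  simp

theorem exists_entire_factor {f : ℂ → ℂ} (hf : Differentiable ℂ f) {w : ℂ} (hw : f w ≠ 0) (a : ℂ) :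
    ∃ u : ℂ → ℂ, Differentiable ℂ u ∧ u a ≠ 0 ∧
      ∀ z, f z = (z - a) ^ analyticOrderNatAt f a * u z := by
  have htop := analyticOrderAt_ne_top_of_entire hf hw a
  obtain ⟨v, hv, hva, hfv⟩ := ((hf.analyticAt a).analyticOrderAt_ne_top).1 htop
  set n := analyticOrderNatAt f a
  classical
  let u : ℂ → ℂ := fun z => if z = a then v a else f z / (z - a) ^ n
  have hu : ∀ᶠ z in 𝓝 a, u z = v z := by
    filter_upwards [hfv] with z hz
    by_cases h : z = a
    · simp [u, h]
    · have : (z - a) ^ n ≠ 0 := pow_ne_zero _ (sub_ne_zero.2 h)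
      simp only [u, h, if_false, hz, smul_eq_mul]
      field_simp
  refine ⟨u, fun z => ?_, by simpa [u] using hva, fun z => ?_⟩
  · by_cases h : z = a
    · subst h
      exact (hv.differentiableAt).congr_of_eventuallyEq hu
    · have h1 : u =ᶠ[𝓝 z] fun z => f z / (z - a) ^ n := by
        filter_upwards [isOpen_ne.mem_nhds h] with y hy
        simp only [u, if_neg hy]
      refine DifferentiableAt.congr_of_eventuallyEq ?_ h1
      exact (hf z).div ((differentiableAt_id.sub_const a).pow n)
        (pow_ne_zero _ (sub_ne_zero.2 h))
  · by_cases h : z = a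
    · subst h
      have := hfv.self_of_nhds
      simpa [u] using this
    · have : (z - a) ^ n ≠ 0 := pow_ne_zero _ (sub_ne_zero.2 h)
      simp only [u, h, if_false]
      field_simp

theorem exists_entire_factor_finset {f : ℂ → ℂ} (hf : Differentiable ℂ f) {w : ℂ} (hw : f w ≠ 0)
    (S : Finset ℂ) :
    ∃ u : ℂ → ℂ, Differentiable ℂ u ∧ (∀ a ∈ S, u a ≠ 0) ∧
      ∀ z, f z = (∏ a ∈ S, (z - a) ^ analyticOrderNatAt f a) * u z := by
  classical
  induction S using Finset.induction_on with
  | empty => exact ⟨f, hf, by simp, by simp⟩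
  | insert a S ha ih =>
    obtain ⟨u, hu, huS, hfu⟩ := ih
    have huw : u w ≠ 0 := by
      intro h
      exact hw (by rw [hfu, h, mul_zero])
    obtain ⟨v, hv, hva, huv⟩ := exists_entire_factor hu huw a
    let P : ℂ → ℂ := fun z => ∏ b ∈ S, (z - b) ^ analyticOrderNatAt f b
    have hP : Differentiable ℂ P := by
      intro z
      simp only [P]
      fun_prop
    have hPa : P a ≠ 0 := by
      refine Finset.prod_ne_zero_iff.2 fun b hb => pow_ne_zero _ (sub_ne_zero.2 ?_)
      rintro rfl
      exact ha hb
    have hord : analyticOrderNatAt f a = analyticOrderNatAt u a := by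
      have hfP : f = P * u := funext hfu
      have h0 : analyticOrderAt P a = 0 := (hP.analyticAt a).analyticOrderAt_eq_zero.2 hPa
      unfold analyticOrderNatAt
      rw [hfP, analyticOrderAt_mul (hP.analyticAt a) (hu.analyticAt a), h0, zero_add]
    refine ⟨v, hv, fun b hb => ?_, fun z => ?_⟩
    · rcases Finset.mem_insert.1 hb with rfl | hb
      · exact hva
      · intro h
        exact huS b hb (by rw [huv, h, mul_zero])
    · rw [Finset.prod_insert ha, hord, hfu z, huv z]
      ring

theorem finite_zeros_closedBall {f : ℂ → ℂ} (hf : Differentiable ℂ f) {w : ℂ} (hw : f w ≠ 0)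
    (ρ : ℝ) : {z ∈ Metric.closedBall (0 : ℂ) ρ | f z = 0}.Finite := by
  by_contra hinf
  obtain ⟨x, -, hx⟩ := (Set.Infinite.exists_accPt_of_subset_isCompact hinf
    (isCompact_closedBall (0 : ℂ) ρ) (fun z hz => hz.1))
  have hfr : ∃ᶠ z in 𝓝[≠] x, f z = 0 := by
    rw [accPt_iff_frequently_nhdsNE] at hx
    exact hx.mono fun z hz => hz.2
  have hfa : AnalyticOnNhd ℂ f Set.univ := fun z _ => hf.analyticAt z
  exact hw (hfa.eqOn_zero_of_preconnected_of_frequently_eq_zero isPreconnected_univ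
    (Set.mem_univ x) hfr (Set.mem_univ w))

theorem zeroCount_eq_sum {f : ℂ → ℂ} {U : Set ℂ} (S : Finset ℂ)
    (hS : ∀ a ∈ U, f a = 0 → a ∈ S) (hSU : ∀ a ∈ S, a ∈ U) :
    zeroCount f U = ∑ a ∈ S, analyticOrderNatAt f a := by
  unfold zeroCount
  rw [finsum_mem_def, finsum_eq_sum_of_support_subset (s := S)]
  · refine Finset.sum_congr rfl fun a ha => ?_
    simp [hSU a ha]
  · intro a ha
    simp only [Function.mem_support, ne_eq, Set.indicator_apply_eq_zero, Classical.not_imp] at ha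
    exact hS a ha.1 (apply_eq_zero_of_analyticOrderNatAt_ne_zero ha.2)

/-- The argument principle for entire functions on a disc centred at `0`. -/
theorem circleIntegral_logDeriv {f : ℂ → ℂ} (hf : Differentiable ℂ f) {ρ : ℝ} (hρ : 0 < ρ)
    (h0 : ∀ z ∈ Metric.sphere (0 : ℂ) ρ, f z ≠ 0) :
    (∮ z in C(0, ρ), logDeriv f z) =
      2 * Real.pi * Complex.I * zeroCount f (Metric.ball 0 ρ) := by
  have hw : f ρ ≠ 0 := h0 _ (by simp [abs_of_pos hρ])
  have hfin := finite_zeros_closedBall hf hw ρ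
  set S := hfin.toFinset
  have hSball : ∀ a ∈ S, a ∈ Metric.ball (0 : ℂ) ρ := by
    intro a ha
    have h := (Set.Finite.mem_toFinset hfin).1 ha
    rcases (Metric.mem_closedBall.1 h.1).lt_or_eq with h1 | h1
    · exact h1
    · exact absurd h.2 (h0 a h1)
  obtain ⟨u, hu, huS, hfu⟩ := exists_entire_factor_finset hf hw S
  have hune : ∀ z ∈ Metric.closedBall (0 : ℂ) ρ, u z ≠ 0 := by
    intro z hz h
    exact huS z ((Set.Finite.mem_toFinset hfin).2 ⟨hz, by rw [hfu, h, mul_zero]⟩) h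
  have hsphne : ∀ z ∈ Metric.sphere (0 : ℂ) ρ, ∀ a ∈ S, z - a ≠ 0 := by
    intro z hz a ha h
    have := hSball a ha
    rw [← sub_eq_zero.1 h, Metric.mem_ball, Metric.mem_sphere.1 hz] at this
    exact lt_irrefl _ this
  have hlog : ∀ z ∈ Metric.sphere (0 : ℂ) ρ,
      logDeriv f z = (∑ a ∈ S, (analyticOrderNatAt f a : ℂ) * (z - a)⁻¹) + logDeriv u z := by
    intro z hz
    have hff : f = fun z => (∏ a ∈ S, (z - a) ^ analyticOrderNatAt f a) * u z := funext hfu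
    conv_lhs => rw [hff]
    rw [logDeriv_mul (f := fun z => ∏ a ∈ S, (z - a) ^ analyticOrderNatAt f a) (g := u)]
    · congr 1
      rw [logDeriv_prod]
      · refine Finset.sum_congr rfl fun a ha => ?_
        rw [logDeriv_fun_pow (by fun_prop)]
        congr 1
        simp [logDeriv_apply]
      · intro a ha
        exact pow_ne_zero _ (hsphne z hz a ha)
      · intro a _
        fun_prop
    · exact Finset.prod_ne_zero_iff.2 fun a ha => pow_ne_zero _ (hsphne z hz a ha)
    · exact hune z (Metric.sphere_subset_closedBall hz)
    · fun_prop
    · exact hu z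
  -- The cofactor `u` has no zeros in the closed disc, so Cauchy's theorem removes its contribution.
  have hud : DifferentiableOn ℂ (logDeriv u) (Metric.closedBall 0 ρ) := by
    intro z hz
    have hdu : Differentiable ℂ (deriv u) := fun x => (hu.analyticAt x).deriv.differentiableAt
    exact ((hdu z).div (hu z) (hune z hz)).differentiableWithinAt
  have hcont : ContinuousOn (logDeriv u) (Metric.sphere 0 ρ) :=
    hud.continuousOn.mono Metric.sphere_subset_closedBall
  have hint : ∀ a ∈ S, CircleIntegrable
      (fun z => (analyticOrderNatAt f a : ℂ) * (z - a)⁻¹) 0 ρ := by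
    intro a ha
    refine ContinuousOn.circleIntegrable hρ.le ?_
    intro z hz
    refine ContinuousAt.continuousWithinAt ?_
    have := hsphne z hz a ha
    fun_prop (disch := assumption)
  have hsum : (∮ z in C(0, ρ), ∑ a ∈ S, (analyticOrderNatAt f a : ℂ) * (z - a)⁻¹) =
      ∑ a ∈ S, (analyticOrderNatAt f a : ℂ) * (2 * Real.pi * Complex.I) := by
    rw [circleIntegral.integral_fun_sum hint]
    refine Finset.sum_congr rfl fun a ha => ?_
    rw [circleIntegral.integral_const_mul,
      circleIntegral.integral_sub_inv_of_mem_ball (hSball a ha)]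
  have hu0 : (∮ z in C(0, ρ), logDeriv u z) = 0 := by
    apply DiffContOnCl.circleIntegral_eq_zero hρ.le
    exact DifferentiableOn.diffContOnCl (hud.mono Metric.closure_ball_subset_closedBall)
  rw [circleIntegral.integral_congr hρ.le hlog, circleIntegral.integral_add, hsum, hu0, add_zero,
    zeroCount_eq_sum S _ hSball, ← Finset.sum_mul]
  · push_cast
    ring
  · intro a ha h
    exact (Set.Finite.mem_toFinset hfin).2 ⟨Metric.ball_subset_closedBall ha, h⟩
  · exact CircleIntegrable.fun_sum S hint
  · exact hcont.circleIntegrable hρ.le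

/-- The theorem of Rouché for entire functions on a disc centred at `0`. -/
theorem zeroCount_eq_of_norm_sub_lt {f g : ℂ → ℂ} (hf : Differentiable ℂ f)
    (hg : Differentiable ℂ g) {ρ : ℝ} (hρ : 0 < ρ)
    (h : ∀ z ∈ Metric.sphere (0 : ℂ) ρ, ‖g z - f z‖ < ‖f z‖) :
    zeroCount g (Metric.ball 0 ρ) = zeroCount f (Metric.ball 0 ρ) := by
  have hf0 : ∀ z ∈ Metric.sphere (0 : ℂ) ρ, f z ≠ 0 := by
    intro z hz h0
    have := h z hz
    rw [h0, norm_zero] at this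
    exact absurd this (not_lt.2 (norm_nonneg _))
  have hg0 : ∀ z ∈ Metric.sphere (0 : ℂ) ρ, g z ≠ 0 := by
    intro z hz h0
    have := h z hz
    rw [h0, zero_sub, norm_neg] at this
    exact lt_irrefl _ this
  have hslit : ∀ z ∈ Metric.sphere (0 : ℂ) ρ, g z / f z ∈ Complex.slitPlane := by
    intro z hz
    have h1 : ‖g z / f z - 1‖ < 1 := by
      rw [div_sub_one (hf0 z hz), norm_div]
      exact (div_lt_one (norm_pos_iff.2 (hf0 z hz))).2 (h z hz)
    left
    have h2 := (Complex.abs_re_le_norm (g z / f z - 1)).trans_lt h1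
    rw [abs_lt] at h2
    simp only [Complex.sub_re, Complex.one_re] at h2
    linarith [h2.1]
  -- On the circle `g / f` stays within distance `1` of `1`, so `log (g / f)` is a primitive of the
  -- integrand.
  have hzero : (∮ z in C(0, ρ), (logDeriv g z - logDeriv f z)) = 0 := by
    refine circleIntegral.integral_eq_zero_of_hasDerivWithinAt hρ.le
      (f := fun z => Complex.log (g z / f z)) fun z hz => ?_
    have h1 := (((hg z).hasDerivAt.fun_div (hf z).hasDerivAt (hf0 z hz)).clog (hslit z hz))
    refine (h1.congr_deriv ?_).hasDerivWithinAt
    have := hf0 z hz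
    have := hg0 z hz
    rw [logDeriv_apply, logDeriv_apply]
    field_simp
  have hci : ∀ k : ℂ → ℂ, Differentiable ℂ k → (∀ z ∈ Metric.sphere (0 : ℂ) ρ, k z ≠ 0) →
      CircleIntegrable (logDeriv k) 0 ρ := by
    intro k hk hk0
    refine ContinuousOn.circleIntegrable hρ.le fun z hz => ContinuousAt.continuousWithinAt ?_
    exact ((hk.analyticAt z).deriv.continuousAt).div (hk z).continuousAt (hk0 z hz)
  rw [circleIntegral.integral_sub (hci g hg hg0) (hci f hf hf0), circleIntegral_logDeriv hg hρ hg0,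
    circleIntegral_logDeriv hf hρ hf0, sub_eq_zero] at hzero
  exact_mod_cast mul_left_cancel₀ Complex.two_pi_I_ne_zero hzero

/-! ### Exponential series with bounded coefficients. -/

/-- The exponential generating function of a coefficient sequence. -/
def expSeries (c : ℕ → ℂ) (x : ℂ) : ℂ := ∑' k : ℕ, c k / (k.factorial : ℂ) * x ^ k

theorem summable_mul_pow_div_factorial (B X : ℝ) :
    Summable fun k : ℕ => B * (X ^ k / (k.factorial : ℝ)) :=
  (Real.summable_pow_div_factorial X).mul_left B

theorem norm_expSeries_term_le {c : ℕ → ℂ} {B : ℝ} (hc : ∀ k, ‖c k‖ ≤ B) {X : ℝ} {x : ℂ}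
    (hx : ‖x‖ ≤ X) (k : ℕ) :
    ‖c k / (k.factorial : ℂ) * x ^ k‖ ≤ B * (X ^ k / (k.factorial : ℝ)) := by
  have hB : 0 ≤ B := (norm_nonneg _).trans (hc k)
  rw [norm_mul, norm_div, norm_pow, Complex.norm_natCast, div_mul_eq_mul_div, mul_div_assoc]
  gcongr
  exact hc k

theorem hasSum_expSeries {c : ℕ → ℂ} {B : ℝ} (hc : ∀ k, ‖c k‖ ≤ B) (x : ℂ) :
    HasSum (fun k : ℕ => c k / (k.factorial : ℂ) * x ^ k) (expSeries c x) :=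
  (Summable.of_norm_bounded (summable_mul_pow_div_factorial B ‖x‖)
    (norm_expSeries_term_le hc le_rfl)).hasSum

theorem expSeries_zero (c : ℕ → ℂ) : expSeries c 0 = c 0 := by
  unfold expSeries
  rw [tsum_eq_single 0]
  · simp
  · intro k hk
    simp [hk]

/-- This is the operator `x d/dx` applied termwise; it serves the recurrence in the order. -/
theorem hasSum_nat_mul_expSeries {c : ℕ → ℂ} {B : ℝ} (hc : ∀ k, ‖c k‖ ≤ B) (x : ℂ) :
    HasSum (fun k : ℕ => (k : ℂ) * (c k / (k.factorial : ℂ) * x ^ k))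
      (x * expSeries (fun k => c (k + 1)) x) := by
  rw [← hasSum_nat_add_iff' 1]
  have h := (hasSum_expSeries (fun k => hc (k + 1)) x).mul_left x
  simp only [Finset.range_one, Finset.sum_singleton, Nat.cast_zero, zero_mul, sub_zero]
  refine h.congr_fun fun k => ?_
  have h1 : ((k : ℂ) + 1) ≠ 0 := Nat.cast_add_one_ne_zero k
  have h2 : (k.factorial : ℂ) ≠ 0 := Nat.cast_ne_zero.2 k.factorial_ne_zero
  rw [Nat.factorial_succ]
  push_cast
  field_simp
  ring

theorem hasDerivAt_expSeries {c : ℕ → ℂ} {B : ℝ} (hc : ∀ k, ‖c k‖ ≤ B) (x : ℂ) :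
    HasDerivAt (expSeries c) (expSeries (fun k => c (k + 1)) x) x := by
  have hx : x ∈ Metric.ball (0 : ℂ) (‖x‖ + 1) := by simp
  have hd : ∀ k : ℕ, DifferentiableOn ℂ (fun x : ℂ => c k / (k.factorial : ℂ) * x ^ k)
      (Metric.ball 0 (‖x‖ + 1)) := fun k => by fun_prop
  have hle : ∀ (k : ℕ) (w : ℂ), w ∈ Metric.ball (0 : ℂ) (‖x‖ + 1) →
      ‖c k / (k.factorial : ℂ) * w ^ k‖ ≤ B * ((‖x‖ + 1) ^ k / (k.factorial : ℝ)) :=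
    fun k w hw => norm_expSeries_term_le hc (mem_ball_zero_iff.1 hw).le k
  have h1 := (Complex.differentiableOn_tsum_of_summable_norm
    (summable_mul_pow_div_factorial B (‖x‖ + 1)) hd Metric.isOpen_ball hle).differentiableAt
    (Metric.isOpen_ball.mem_nhds hx)
  have h2 := Complex.hasSum_deriv_of_summable_norm
    (summable_mul_pow_div_factorial B (‖x‖ + 1)) hd Metric.isOpen_ball hle hx
  have h3 : HasSum (fun k : ℕ => deriv (fun x : ℂ => c k / (k.factorial : ℂ) * x ^ k) x)
      (expSeries (fun k => c (k + 1)) x) := by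
    rw [← hasSum_nat_add_iff' 1]
    have h := hasSum_expSeries (fun k => hc (k + 1)) x
    simp only [Finset.range_one, Finset.sum_singleton, pow_zero, mul_one, deriv_const, sub_zero]
    refine h.congr_fun fun k => ?_
    have h1 : ((k : ℂ) + 1) ≠ 0 := Nat.cast_add_one_ne_zero k
    have h2 : (k.factorial : ℂ) ≠ 0 := Nat.cast_ne_zero.2 k.factorial_ne_zero
    rw [deriv_const_mul _ (by fun_prop), deriv_pow_field, Nat.factorial_succ]
    push_cast
    field_simp
  exact (h2.unique h3) ▸ h1.hasDerivAt

/-! ### The entire factor `Λ_μ` of the Bessel function, `J_μ(z) = (z/2)^μ Λ_μ(z²/4)`. -/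

/-- The entire function `1 / Γ`. -/
def rGamma (w : ℂ) : ℂ := (Complex.Gamma w)⁻¹

theorem differentiable_rGamma : Differentiable ℂ rGamma := Complex.differentiable_one_div_Gamma

theorem rGamma_eq (w : ℂ) : rGamma w = w * rGamma (w + 1) :=
  Complex.one_div_Gamma_eq_self_mul_one_div_Gamma_add_one w

/-- For `k ≤ ⌈M⌉` the arguments lie in a fixed compact ball. Beyond that, `1/Γ(w+1) = (1/Γ(w))/w`
with `|w| ≥ 1`, so the moduli do not increase with `k`. -/
theorem exists_bound_rGamma (M : ℝ) : ∃ B : ℝ, ∀ μ : ℂ, ‖μ‖ ≤ M → ∀ k : ℕ,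
    ‖rGamma (μ + k + 1)‖ ≤ B := by
  set K := ⌈M⌉₊
  obtain ⟨B, hB⟩ := (isCompact_closedBall (0 : ℂ) (M + K + 1)).exists_bound_of_continuousOn
    differentiable_rGamma.continuous.continuousOn
  refine ⟨B, fun μ hμ k => ?_⟩
  have hsmall : ∀ k : ℕ, k ≤ K → ‖rGamma (μ + k + 1)‖ ≤ B := by
    intro k hk
    refine hB _ (mem_closedBall_zero_iff.2 ?_)
    have hk' : (k : ℝ) ≤ K := by exact_mod_cast hk
    calc ‖μ + k + 1‖ ≤ ‖μ‖ + ‖(k : ℂ)‖ + ‖(1 : ℂ)‖ := norm_add₃_le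
      _ ≤ M + K + 1 := by
        rw [Complex.norm_natCast, norm_one]
        linarith
  rcases le_or_gt k K with h | h
  · exact hsmall k h
  · induction k, h.le using Nat.le_induction with
    | base => exact hsmall K le_rfl
    | succ j hj ih =>
      have hbj : ‖rGamma (μ + j + 1)‖ ≤ B := by
        rcases hj.lt_or_eq with h | h
        · exact ih h
        · exact hsmall j h.symm.le
      refine le_trans ?_ hbj
      rw [rGamma_eq (μ + j + 1), norm_mul]
      have h1 : 1 ≤ ‖μ + j + 1‖ := by
        have h2 := Complex.re_le_norm (μ + j + 1)
        have h3 := (abs_le.1 ((Complex.abs_re_le_norm μ).trans hμ)).1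
        have h4 : M ≤ j := (Nat.le_ceil M).trans (by exact_mod_cast hj)
        simp at h2
        linarith
      push_cast
      rw [show μ + (j + 1 : ℂ) + 1 = μ + j + 1 + 1 by ring]
      exact le_mul_of_one_le_left (norm_nonneg _) h1

/-- Cauchy's estimate on circles of radius `1`, whence the enlarged bound `M + 1`. -/
theorem exists_bound_deriv_rGamma (M : ℝ) : ∃ B : ℝ, ∀ μ : ℂ, ‖μ‖ ≤ M → ∀ k : ℕ,
    ‖deriv rGamma (μ + k + 1)‖ ≤ B := by
  obtain ⟨B, hB⟩ := exists_bound_rGamma (M + 1)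
  refine ⟨B, fun μ hμ k => ?_⟩
  have h := Complex.norm_deriv_le_of_forall_mem_sphere_norm_le (f := rGamma) (c := μ + k + 1)
    (R := 1) (C := B) one_pos differentiable_rGamma.diffContOnCl ?_
  · simpa using h
  · intro z hz
    have h1 : ‖z - (k + 1)‖ ≤ M + 1 := by
      calc ‖z - (k + 1)‖ = ‖μ + (z - (μ + k + 1))‖ := by ring_nf
        _ ≤ ‖μ‖ + ‖z - (μ + k + 1)‖ := norm_add_le _ _
        _ ≤ M + 1 := by
          rw [mem_sphere_iff_norm.1 hz]
          linarith
    have h2 := hB _ h1 k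
    rwa [show z - (k + 1) + k + 1 = z by ring] at h2

/-- The entire function `Λ_μ(x) = ∑ (-x)^k / (k! Γ(μ+k+1))`. -/
def besselEntire (μ x : ℂ) : ℂ := expSeries (fun k => (-1) ^ k * rGamma (μ + k + 1)) x

/-- The derivative of `besselEntire` with respect to the order. -/
def besselEntireOrder (μ x : ℂ) : ℂ := expSeries (fun k => (-1) ^ k * deriv rGamma (μ + k + 1)) x

theorem exists_bound_coeff (μ : ℂ) : ∃ B : ℝ, ∀ k : ℕ,
    ‖(-1 : ℂ) ^ k * rGamma (μ + k + 1)‖ ≤ B := by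
  obtain ⟨B, hB⟩ := exists_bound_rGamma ‖μ‖
  exact ⟨B, fun k => by simpa using hB μ le_rfl k⟩

theorem exists_bound_coeff_order (μ : ℂ) : ∃ B : ℝ, ∀ k : ℕ,
    ‖(-1 : ℂ) ^ k * deriv rGamma (μ + k + 1)‖ ≤ B := by
  obtain ⟨B, hB⟩ := exists_bound_deriv_rGamma ‖μ‖
  exact ⟨B, fun k => by simpa using hB μ le_rfl k⟩

theorem expSeries_neg (c : ℕ → ℂ) (x : ℂ) : expSeries (fun k => -c k) x = -expSeries c x := by
  unfold expSeries
  rw [← tsum_neg]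
  exact tsum_congr fun k => by ring

theorem hasDerivAt_besselEntire (μ x : ℂ) :
    HasDerivAt (besselEntire μ) (-besselEntire (μ + 1) x) x := by
  obtain ⟨B, hB⟩ := exists_bound_coeff μ
  refine (hasDerivAt_expSeries hB x).congr_deriv ?_
  rw [besselEntire, ← expSeries_neg]
  congr 1
  funext k
  push_cast
  rw [show μ + (k + 1 : ℂ) + 1 = μ + 1 + k + 1 by ring]
  ring

theorem hasDerivAt_besselEntireOrder (μ x : ℂ) :
    HasDerivAt (besselEntireOrder μ) (-besselEntireOrder (μ + 1) x) x := by
  obtain ⟨B, hB⟩ := exists_bound_coeff_order μ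
  refine (hasDerivAt_expSeries hB x).congr_deriv ?_
  rw [besselEntireOrder, ← expSeries_neg]
  congr 1
  funext k
  push_cast
  rw [show μ + (k + 1 : ℂ) + 1 = μ + 1 + k + 1 by ring]
  ring

/-- Split `1/Γ(μ+k+1) = ((μ+1) + k)/Γ(μ+k+2)` in each coefficient; the part with `k` is `x d/dx` of
`Λ_{μ+1}`. -/
theorem besselEntire_recurrence (μ x : ℂ) :
    besselEntire μ x = (μ + 1) * besselEntire (μ + 1) x - x * besselEntire (μ + 2) x := by
  obtain ⟨B, hB⟩ := exists_bound_coeff μ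
  obtain ⟨B', hB'⟩ := exists_bound_coeff (μ + 1)
  have h0 := hasSum_expSeries hB x
  have h1 := (hasSum_expSeries hB' x).mul_left (μ + 1)
  have h2 := hasSum_nat_mul_expSeries hB' x
  have h3 : expSeries (fun k => (-1) ^ (k + 1) * rGamma (μ + 1 + (k + 1 : ℕ) + 1)) x =
      -besselEntire (μ + 2) x := by
    rw [besselEntire, ← expSeries_neg]
    congr 1
    funext k
    push_cast
    rw [show μ + 1 + (k + 1 : ℂ) + 1 = μ + 2 + k + 1 by ring]
    ring
  rw [h3] at h2
  have h4 := h0.unique ((h1.add h2).congr_fun fun k => ?_)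
  · change besselEntire μ x = _ at h4
    rw [h4]
    change (μ + 1) * besselEntire (μ + 1) x + _ = _
    ring
  · rw [rGamma_eq (μ + k + 1), show μ + 1 + (k : ℂ) + 1 = μ + k + 1 + 1 by ring]
    ring

/-- Differentiability in the order is needed because `Y_n` at an integer `n` is a limit in the
order. -/
theorem hasDerivAt_besselEntire_order (μ x : ℂ) :
    HasDerivAt (fun m => besselEntire m x) (besselEntireOrder μ x) μ := by
  obtain ⟨B, hB⟩ := exists_bound_rGamma (‖μ‖ + 1)
  have hμ : μ ∈ Metric.ball (0 : ℂ) (‖μ‖ + 1) := by simp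
  have hd : ∀ k : ℕ, DifferentiableOn ℂ
      (fun m : ℂ => (-1) ^ k * rGamma (m + k + 1) / (k.factorial : ℂ) * x ^ k)
      (Metric.ball 0 (‖μ‖ + 1)) := fun k => by
    have := differentiable_rGamma
    fun_prop
  have hle : ∀ (k : ℕ) (m : ℂ), m ∈ Metric.ball (0 : ℂ) (‖μ‖ + 1) →
      ‖(-1) ^ k * rGamma (m + k + 1) / (k.factorial : ℂ) * x ^ k‖ ≤
        B * (‖x‖ ^ k / (k.factorial : ℝ)) := by
    intro k m hm
    rw [norm_mul, norm_div, norm_pow, Complex.norm_natCast, div_mul_eq_mul_div, mul_div_assoc]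
    gcongr
    simpa using hB m (mem_ball_zero_iff.1 hm).le k
  have h1 := (Complex.differentiableOn_tsum_of_summable_norm
    (summable_mul_pow_div_factorial B ‖x‖) hd Metric.isOpen_ball hle).differentiableAt
    (Metric.isOpen_ball.mem_nhds hμ)
  have h2 := Complex.hasSum_deriv_of_summable_norm
    (summable_mul_pow_div_factorial B ‖x‖) hd Metric.isOpen_ball hle hμ
  obtain ⟨B', hB'⟩ := exists_bound_coeff_order μ
  have h3 : HasSum (fun k : ℕ => deriv
      (fun m : ℂ => (-1) ^ k * rGamma (m + k + 1) / (k.factorial : ℂ) * x ^ k) μ)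
      (besselEntireOrder μ x) := by
    refine (hasSum_expSeries hB' x).congr_fun fun k => ?_
    have h4 : HasDerivAt (fun m : ℂ => rGamma (m + k + 1)) (deriv rGamma (μ + k + 1)) μ := by
      have h5 : HasDerivAt (fun m : ℂ => m + k + 1) 1 μ :=
        ((hasDerivAt_id μ).add_const (k : ℂ)).add_const 1
      have := ((differentiable_rGamma (μ + k + 1)).hasDerivAt).comp μ h5
      rwa [mul_one] at this
    exact (((h4.const_mul ((-1) ^ k)).div_const _).mul_const _).deriv
  rw [← h2.unique h3]
  exact h1.hasDerivAt

theorem besselEntire_zero (μ : ℂ) : besselEntire μ 0 = rGamma (μ + 1) := by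
  simp [besselEntire, expSeries_zero]

theorem rGamma_mul_rGamma_one_sub (μ : ℂ) :
    rGamma μ * rGamma (1 - μ) = Complex.sin (Real.pi * μ) / Real.pi := by
  rw [rGamma, rGamma, ← mul_inv, Complex.Gamma_mul_Gamma_one_sub, inv_div]

/-- The left side is the Wronskian of `J_μ` and `J_{-μ}` with the powers cancelled. The recurrences
for `μ` and `-μ` make its derivative vanish, and the reflection formula for `Γ` evaluates it at `x =
0`. -/
theorem besselEntire_wronskian (μ x : ℂ) :
    -2 * μ * besselEntire μ x * besselEntire (-μ) x
      - 2 * x * besselEntire μ x * besselEntire (-μ + 1) x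
      + 2 * x * besselEntire (-μ) x * besselEntire (μ + 1) x =
    -2 * Complex.sin (Real.pi * μ) / Real.pi := by
  set W : ℂ → ℂ := fun x => -2 * μ * besselEntire μ x * besselEntire (-μ) x
      - 2 * x * besselEntire μ x * besselEntire (-μ + 1) x
      + 2 * x * besselEntire (-μ) x * besselEntire (μ + 1) x with hW
  have hd : ∀ x, HasDerivAt W 0 x := by
    intro x
    have a := hasDerivAt_besselEntire μ x
    have b := hasDerivAt_besselEntire (-μ) x
    have c := hasDerivAt_besselEntire (-μ + 1) x
    have d := hasDerivAt_besselEntire (μ + 1) x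
    have e := (hasDerivAt_id x).const_mul (2 : ℂ)
    refine (((a.const_mul (-2 * μ)).mul b).sub ((e.mul a).mul c) |>.add
      ((e.mul b).mul d)).congr_deriv ?_
    have r1 := besselEntire_recurrence μ x
    have r2 := besselEntire_recurrence (-μ) x
    rw [show -μ + 2 = -μ + 1 + 1 by ring] at r2
    rw [show μ + 2 = μ + 1 + 1 by ring] at r1
    simp only [id, mul_one, Pi.mul_apply]
    linear_combination (-2 * besselEntire (-μ) x) * r1 + 2 * besselEntire μ x * r2
  have hconst := is_const_of_deriv_eq_zero (fun x => (hd x).differentiableAt)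
    (fun x => (hd x).deriv) x 0
  change W x = _
  rw [hconst, hW]
  simp only [besselEntire_zero, mul_zero, zero_mul, sub_zero, add_zero]
  rw [mul_assoc (-2 : ℂ), ← rGamma_eq, mul_assoc, show -μ + 1 = 1 - μ by ring,
    rGamma_mul_rGamma_one_sub, mul_div_assoc]

/-! ### Bessel functions in the logarithmic variable, where no branch cut remains. -/

/-- `J_μ(e^τ)`, an entire function of `μ` and of `τ`. -/
def logJ (μ τ : ℂ) : ℂ :=
  Complex.exp (μ * (τ - Real.log 2)) * besselEntire μ (Complex.exp τ ^ 2 / 4)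

/-- The `τ`-derivative of `logJ`. -/
def logJDeriv (μ τ : ℂ) : ℂ := μ * logJ μ τ - Complex.exp τ * logJ (μ + 1) τ

/-- The `μ`-derivative of `logJ`. -/
def logJOrder (μ τ : ℂ) : ℂ :=
  (τ - Real.log 2) * logJ μ τ
    + Complex.exp (μ * (τ - Real.log 2)) * besselEntireOrder μ (Complex.exp τ ^ 2 / 4)

/-- The mixed second derivative of `logJ`. -/
def logJOrderDeriv (μ τ : ℂ) : ℂ :=
  logJ μ τ + μ * logJOrder μ τ - Complex.exp τ * logJOrder (μ + 1) τ

theorem exp_add_one_mul_sub_log_two (μ τ : ℂ) :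
    Complex.exp ((μ + 1) * (τ - Real.log 2)) =
      Complex.exp (μ * (τ - Real.log 2)) * (Complex.exp τ / 2) := by
  rw [add_mul, one_mul, Complex.exp_add, Complex.exp_sub, ← Complex.ofReal_exp,
    Real.exp_log two_pos]
  norm_num

theorem hasDerivAt_exp_sq_div_four (τ : ℂ) :
    HasDerivAt (fun τ => Complex.exp τ ^ 2 / 4) (Complex.exp τ ^ 2 / 2) τ := by
  refine (((Complex.hasDerivAt_exp τ).pow 2).div_const 4).congr_deriv ?_
  push_cast
  ring

theorem hasDerivAt_exp_mul_sub (μ τ : ℂ) :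
    HasDerivAt (fun τ => Complex.exp (μ * (τ - Real.log 2)))
      (μ * Complex.exp (μ * (τ - Real.log 2))) τ := by
  have h := ((((hasDerivAt_id τ).sub_const (Real.log 2 : ℂ)).const_mul μ)).cexp
  simp only [id, mul_one] at h
  exact h.congr_deriv (mul_comm _ _)

theorem hasDerivAt_logJ (μ τ : ℂ) : HasDerivAt (logJ μ) (logJDeriv μ τ) τ := by
  have h1 := (hasDerivAt_besselEntire μ (Complex.exp τ ^ 2 / 4)).comp τ
    (hasDerivAt_exp_sq_div_four τ)
  refine ((hasDerivAt_exp_mul_sub μ τ).mul h1).congr_deriv ?_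
  simp only [logJDeriv, logJ, exp_add_one_mul_sub_log_two, Function.comp]
  ring

theorem hasDerivAt_logJ_order (μ τ : ℂ) :
    HasDerivAt (fun m => logJ m τ) (logJOrder μ τ) μ := by
  have h := (((hasDerivAt_id μ).mul_const (τ - Real.log 2 : ℂ))).cexp
  simp only [id, one_mul] at h
  refine (h.mul (hasDerivAt_besselEntire_order μ (Complex.exp τ ^ 2 / 4))).congr_deriv ?_
  simp only [logJOrder, logJ]
  ring

theorem hasDerivAt_logJOrder (μ τ : ℂ) :
    HasDerivAt (logJOrder μ) (logJOrderDeriv μ τ) τ := by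
  have h1 := (hasDerivAt_besselEntireOrder μ (Complex.exp τ ^ 2 / 4)).comp τ
    (hasDerivAt_exp_sq_div_four τ)
  have h2 := ((hasDerivAt_id τ).sub_const (Real.log 2 : ℂ)).mul (hasDerivAt_logJ μ τ)
  refine (h2.add ((hasDerivAt_exp_mul_sub μ τ).mul h1)).congr_deriv ?_
  simp only [logJOrderDeriv, logJOrder, logJDeriv, logJ, exp_add_one_mul_sub_log_two,
    Function.comp, id]
  ring

theorem logJ_recurrence (μ τ : ℂ) :
    Complex.exp τ * (logJ μ τ + logJ (μ + 2) τ) = 2 * (μ + 1) * logJ (μ + 1) τ := by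
  have h := besselEntire_recurrence μ (Complex.exp τ ^ 2 / 4)
  simp only [logJ]
  rw [show μ + 2 = μ + 1 + 1 by ring] at h ⊢
  rw [exp_add_one_mul_sub_log_two, exp_add_one_mul_sub_log_two, h]
  ring

theorem logJOrder_recurrence (μ τ : ℂ) :
    Complex.exp τ * (logJOrder μ τ + logJOrder (μ + 2) τ) =
      2 * logJ (μ + 1) τ + 2 * (μ + 1) * logJOrder (μ + 1) τ := by
  have hs : ∀ c : ℂ, HasDerivAt (fun m => logJ (m + c) τ) (logJOrder (μ + c) τ) μ := by
    intro c
    exact (hasDerivAt_logJ_order (μ + c) τ).comp_add_const μ c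
  have h1 : HasDerivAt (fun m => Complex.exp τ * (logJ m τ + logJ (m + 2) τ))
      (Complex.exp τ * (logJOrder μ τ + logJOrder (μ + 2) τ)) μ :=
    ((hasDerivAt_logJ_order μ τ).add (hs 2)).const_mul _
  have h2 := ((((hasDerivAt_id μ).add_const (1 : ℂ)).const_mul 2).mul (hs 1))
  have h3 : (fun m => Complex.exp τ * (logJ m τ + logJ (m + 2) τ)) =
      (fun m => 2 * (id m + 1)) * (fun m => logJ (m + 1) τ) :=
    funext fun m => logJ_recurrence m τ
  rw [← h3] at h2
  rw [h1.unique h2]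
  simp only [id]
  ring

theorem hasDerivAt_logJDeriv (μ τ : ℂ) :
    HasDerivAt (logJDeriv μ) ((μ ^ 2 - Complex.exp τ ^ 2) * logJ μ τ) τ := by
  refine (((hasDerivAt_logJ μ τ).const_mul μ).sub
    ((Complex.hasDerivAt_exp τ).mul (hasDerivAt_logJ (μ + 1) τ))).congr_deriv ?_
  have h := logJ_recurrence μ τ
  simp only [logJDeriv]
  rw [show μ + 2 = μ + 1 + 1 by ring] at h
  linear_combination Complex.exp τ * h

/-- The Bessel equation differentiated in `μ`; this produces the inhomogeneous term `2 μ J_μ`. -/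
theorem hasDerivAt_logJOrderDeriv (μ τ : ℂ) :
    HasDerivAt (logJOrderDeriv μ)
      ((μ ^ 2 - Complex.exp τ ^ 2) * logJOrder μ τ + 2 * μ * logJ μ τ) τ := by
  refine (((hasDerivAt_logJ μ τ).add ((hasDerivAt_logJOrder μ τ).const_mul μ)).sub
    ((Complex.hasDerivAt_exp τ).mul (hasDerivAt_logJOrder (μ + 1) τ))).congr_deriv ?_
  have h := logJOrder_recurrence μ τ
  simp only [logJOrderDeriv, logJDeriv]
  rw [show μ + 2 = μ + 1 + 1 by ring] at h
  linear_combination Complex.exp τ * h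

theorem hasDerivAt_logJDeriv_order (μ τ : ℂ) :
    HasDerivAt (fun m => logJDeriv m τ) (logJOrderDeriv μ τ) μ := by
  have hs : HasDerivAt (fun m => logJ (m + 1) τ) (logJOrder (μ + 1) τ) μ :=
    (hasDerivAt_logJ_order (μ + 1) τ).comp_add_const μ 1
  refine (((hasDerivAt_id μ).mul (hasDerivAt_logJ_order μ τ)).sub
    (hs.const_mul (Complex.exp τ))).congr_deriv ?_
  simp [logJOrderDeriv]

theorem logJ_wronskian_neg (μ τ : ℂ) :
    logJ μ τ * logJDeriv (-μ) τ - logJDeriv μ τ * logJ (-μ) τ =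
      -2 * Complex.sin (Real.pi * μ) / Real.pi := by
  rw [← besselEntire_wronskian μ (Complex.exp τ ^ 2 / 4)]
  have hE : Complex.exp (μ * (τ - Real.log 2)) * Complex.exp (-μ * (τ - Real.log 2)) = 1 := by
    rw [← Complex.exp_add, ← Complex.exp_zero]
    ring_nf
  simp only [logJDeriv, logJ, exp_add_one_mul_sub_log_two]
  linear_combination (-2 * μ * besselEntire μ (Complex.exp τ ^ 2 / 4) *
      besselEntire (-μ) (Complex.exp τ ^ 2 / 4)
      - 2 * (Complex.exp τ ^ 2 / 4) * besselEntire μ (Complex.exp τ ^ 2 / 4) *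
      besselEntire (-μ + 1) (Complex.exp τ ^ 2 / 4)
      + 2 * (Complex.exp τ ^ 2 / 4) * besselEntire (-μ) (Complex.exp τ ^ 2 / 4) *
      besselEntire (μ + 1) (Complex.exp τ ^ 2 / 4)) * hE

/-- Two consecutive orders are carried through the induction because the recurrence has three terms.
It starts at order `-1`, where the coefficient `2(μ+1)` vanishes and forces `J_{-1} = -J_1`. -/
theorem logJ_neg_natCast (n : ℕ) (τ : ℂ) :
    logJ (-(n : ℂ)) τ = (-1) ^ n * logJ n τ ∧
      logJ (-(n : ℂ) - 1) τ = (-1) ^ (n + 1) * logJ (n + 1) τ := by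
  induction n with
  | zero =>
    refine ⟨by simp, ?_⟩
    have h := logJ_recurrence (-1) τ
    rw [show (-1 : ℂ) + 2 = 1 by ring, neg_add_cancel, mul_zero, zero_mul] at h
    have h1 := (mul_eq_zero.1 h).resolve_left (Complex.exp_ne_zero τ)
    simp only [Nat.cast_zero, neg_zero, zero_sub, zero_add, pow_one]
    linear_combination h1
  | succ n ih =>
    obtain ⟨h0, h1⟩ := ih
    push_cast
    refine ⟨by rw [neg_add']; exact h1, ?_⟩
    have ha := logJ_recurrence (n : ℂ) τ
    have hb := logJ_recurrence (-(n : ℂ) - 2) τ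
    rw [show -(n : ℂ) - 2 + 2 = -(n : ℂ) by ring, show -(n : ℂ) - 2 + 1 = -(n : ℂ) - 1 by ring,
      h0, h1] at hb
    rw [show -((n : ℂ) + 1) - 1 = -(n : ℂ) - 2 by ring, show (n : ℂ) + 1 + 1 = n + 2 by ring]
    refine mul_left_cancel₀ (Complex.exp_ne_zero τ) ?_
    linear_combination hb - (-1) ^ n * ha

theorem logJ_neg_intCast (n : ℤ) (τ : ℂ) :
    logJ (-(n : ℂ)) τ = Complex.cos (n * Real.pi) * logJ n τ := by
  have hnat : ∀ n : ℕ, logJ (-(n : ℂ)) τ = Complex.cos (n * Real.pi) * logJ n τ := by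
    intro n
    rw [(logJ_neg_natCast n τ).1]
    congr 1
    have := Real.cos_nat_mul_pi n
    rw [← Complex.ofReal_inj] at this
    push_cast at this
    exact this.symm
  obtain ⟨m, rfl | rfl⟩ := n.eq_nat_or_neg
  · exact_mod_cast hnat m
  · push_cast
    have h := hnat m
    have hc : Complex.cos (m * Real.pi) ^ 2 = 1 := by
      have := Complex.sin_sq_add_cos_sq (m * Real.pi)
      rw [Complex.sin_nat_mul_pi] at this
      simpa using this
    rw [neg_neg, neg_mul, Complex.cos_neg, h]
    linear_combination -logJ m τ * hc

theorem logJDeriv_neg_intCast (n : ℤ) (τ : ℂ) :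
    logJDeriv (-(n : ℂ)) τ = Complex.cos (n * Real.pi) * logJDeriv n τ := by
  have h : logJ (-(n : ℂ)) = fun τ => Complex.cos (n * Real.pi) * logJ n τ :=
    funext (logJ_neg_intCast n)
  have h1 := hasDerivAt_logJ (-(n : ℂ)) τ
  rw [h] at h1
  exact h1.unique ((hasDerivAt_logJ n τ).const_mul _)

theorem sin_intCast_mul_pi (n : ℤ) : Complex.sin (n * Real.pi) = 0 := Complex.sin_int_mul_pi n

theorem cos_intCast_mul_pi_sq (n : ℤ) : Complex.cos (n * Real.pi) ^ 2 = 1 := by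
  have := Complex.sin_sq_add_cos_sq (n * Real.pi)
  rw [sin_intCast_mul_pi] at this
  simpa using this

theorem sin_mul_pi_ne_zero {μ : ℂ} (h : ¬∃ n : ℤ, μ = n) : Complex.sin (μ * Real.pi) ≠ 0 := by
  rw [Ne, Complex.sin_eq_zero_iff]
  rintro ⟨k, hk⟩
  exact h ⟨k, mul_right_cancel₀ (Complex.ofReal_ne_zero.2 Real.pi_ne_zero) hk⟩

open Classical in
/-- `Y_μ(e^τ)`, an entire function of `τ`. -/
def logY (μ τ : ℂ) : ℂ :=
  if ∃ n : ℤ, μ = n then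
    (logJOrder μ τ + Complex.cos (μ * Real.pi) * logJOrder (-μ) τ) / Real.pi
  else (logJ μ τ * Complex.cos (μ * Real.pi) - logJ (-μ) τ) / Complex.sin (μ * Real.pi)

open Classical in
/-- The `τ`-derivative of `logY`. -/
def logYDeriv (μ τ : ℂ) : ℂ :=
  if ∃ n : ℤ, μ = n then
    (logJOrderDeriv μ τ + Complex.cos (μ * Real.pi) * logJOrderDeriv (-μ) τ) / Real.pi
  else (logJDeriv μ τ * Complex.cos (μ * Real.pi) - logJDeriv (-μ) τ) / Complex.sin (μ * Real.pi)

theorem logY_of_int {μ : ℂ} (h : ∃ n : ℤ, μ = n) : logY μ = fun τ =>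
    (logJOrder μ τ + Complex.cos (μ * Real.pi) * logJOrder (-μ) τ) / Real.pi :=
  funext fun _ => if_pos h

theorem logY_of_not_int {μ : ℂ} (h : ¬∃ n : ℤ, μ = n) : logY μ = fun τ =>
    (logJ μ τ * Complex.cos (μ * Real.pi) - logJ (-μ) τ) / Complex.sin (μ * Real.pi) :=
  funext fun _ => if_neg h

theorem logYDeriv_of_int {μ : ℂ} (h : ∃ n : ℤ, μ = n) : logYDeriv μ = fun τ =>
    (logJOrderDeriv μ τ + Complex.cos (μ * Real.pi) * logJOrderDeriv (-μ) τ) / Real.pi :=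
  funext fun _ => if_pos h

theorem logYDeriv_of_not_int {μ : ℂ} (h : ¬∃ n : ℤ, μ = n) : logYDeriv μ = fun τ =>
    (logJDeriv μ τ * Complex.cos (μ * Real.pi) - logJDeriv (-μ) τ) / Complex.sin (μ * Real.pi) :=
  funext fun _ => if_neg h

theorem hasDerivAt_logY (μ τ : ℂ) : HasDerivAt (logY μ) (logYDeriv μ τ) τ := by
  by_cases h : ∃ n : ℤ, μ = n
  · rw [logY_of_int h, logYDeriv_of_int h]
    exact ((hasDerivAt_logJOrder μ τ).add ((hasDerivAt_logJOrder (-μ) τ).const_mul _)).div_const _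
  · rw [logY_of_not_int h, logYDeriv_of_not_int h]
    exact (((hasDerivAt_logJ μ τ).mul_const _).sub (hasDerivAt_logJ (-μ) τ)).div_const _

theorem hasDerivAt_logYDeriv (μ τ : ℂ) :
    HasDerivAt (logYDeriv μ) ((μ ^ 2 - Complex.exp τ ^ 2) * logY μ τ) τ := by
  by_cases h : ∃ n : ℤ, μ = n
  · rw [logY_of_int h, logYDeriv_of_int h]
    refine (((hasDerivAt_logJOrderDeriv μ τ).add
      ((hasDerivAt_logJOrderDeriv (-μ) τ).const_mul _)).div_const _).congr_deriv ?_
    obtain ⟨n, rfl⟩ := h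
    rw [logJ_neg_intCast]
    -- The inhomogeneous terms for the orders `n` and `-n` cancel, since `J_{-n} = cos(nπ) J_n` and
    -- `cos²(nπ) = 1`.
    have hc := cos_intCast_mul_pi_sq n
    linear_combination (-2 * n * logJ n τ / Real.pi) * hc
  · rw [logY_of_not_int h, logYDeriv_of_not_int h]
    refine ((((hasDerivAt_logJDeriv μ τ).mul_const _).sub
      (hasDerivAt_logJDeriv (-μ) τ)).div_const _).congr_deriv ?_
    ring

theorem logJ_logY_wronskian (μ τ : ℂ) :
    logJ μ τ * logYDeriv μ τ - logJDeriv μ τ * logY μ τ = 2 / Real.pi := by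
  have hpi : (Real.pi : ℂ) ≠ 0 := Complex.ofReal_ne_zero.2 Real.pi_ne_zero
  by_cases h : ∃ n : ℤ, μ = n
  · rw [logY_of_int h, logYDeriv_of_int h]
    obtain ⟨n, rfl⟩ := h
    have hneg : ∀ {f : ℂ → ℂ} {f' : ℂ}, HasDerivAt f f' (-(n : ℂ)) →
        HasDerivAt (fun m => f (-m)) (-f') (n : ℂ) := by
      intro f f' hf
      have := hf.comp (n : ℂ) (hasDerivAt_neg (n : ℂ))
      exact this.congr_deriv (by ring)
    -- Differentiate the Wronskian of `J_m` and `J_{-m}` in `m` at `m = n`.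
    have h1 := ((hasDerivAt_logJ_order (n : ℂ) τ).mul
      (hneg (hasDerivAt_logJDeriv_order (-(n : ℂ)) τ))).sub
      ((hasDerivAt_logJDeriv_order (n : ℂ) τ).mul (hneg (hasDerivAt_logJ_order (-(n : ℂ)) τ)))
    have h2 : HasDerivAt (fun m : ℂ => -2 * Complex.sin (Real.pi * m) / Real.pi)
        (-2 * Complex.cos (n * Real.pi)) n := by
      have h3 := ((((hasDerivAt_id (n : ℂ)).const_mul (Real.pi : ℂ)).csin.const_mul
        (-2)).div_const (Real.pi : ℂ))
      refine h3.congr_deriv ?_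
      simp only [id, mul_comm (Real.pi : ℂ)]
      field_simp
    have h3 := (h1.congr_of_eventuallyEq (Eventually.of_forall
      fun m => (logJ_wronskian_neg m τ).symm)).unique h2
    simp only [logJ_neg_intCast, logJDeriv_neg_intCast] at h3
    have hc := cos_intCast_mul_pi_sq n
    field_simp
    linear_combination (-Complex.cos (n * Real.pi)) * h3 +
      (logJOrder n τ * logJDeriv n τ - logJOrderDeriv n τ * logJ n τ + 2) * hc
  · rw [logY_of_not_int h, logYDeriv_of_not_int h]
    have hs := sin_mul_pi_ne_zero h
    have hw := logJ_wronskian_neg μ τ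
    rw [mul_comm (Real.pi : ℂ)] at hw
    field_simp at hw ⊢
    linear_combination -hw

/-! ### Identification with the principal branches of `J`, `Y` and their derivatives. -/

theorem log_div_two {z : ℂ} (hz : z ≠ 0) : Complex.log (z / 2) = Complex.log z - Real.log 2 := by
  rw [show z / 2 = ((2⁻¹ : ℝ) : ℂ) * z by push_cast; ring,
    Complex.log_ofReal_mul (by norm_num) hz, Real.log_inv]
  push_cast
  ring

theorem besselJ_eq_logJ (μ : ℂ) {z : ℂ} (hz : z ≠ 0) :
    besselJ μ z = logJ μ (Complex.log z) := by
  rw [besselJ, logJ, Complex.cpow_def_of_ne_zero (div_ne_zero hz two_ne_zero), log_div_two hz,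
    Complex.exp_log hz, mul_comm μ, besselEntire, expSeries]
  congr 1
  refine tsum_congr fun k => ?_
  rw [rGamma, pow_mul, div_pow, show (2 : ℂ) ^ 2 = 4 by norm_num, div_mul_eq_div_div,
    div_right_comm, div_eq_mul_inv ((-1 : ℂ) ^ k)]

/-- Numerator and denominator vanish at `μ = n`, so the limit is the quotient of their derivatives
in the order. This is the source of the integer case of `logY`. -/
theorem tendsto_besselYQuot (n : ℤ) {z : ℂ} (hz : z ≠ 0) :
    Tendsto (fun μ => besselYQuot μ z) (𝓝[≠] (n : ℂ)) (𝓝 (logY n (Complex.log z))) := by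
  have hpi : (Real.pi : ℂ) ≠ 0 := Complex.ofReal_ne_zero.2 Real.pi_ne_zero
  set τ := Complex.log z
  have hcos : HasDerivAt (fun m : ℂ => Complex.cos (m * Real.pi)) 0 (n : ℂ) := by
    have h := ((hasDerivAt_id (n : ℂ)).mul_const (Real.pi : ℂ)).ccos
    simp only [id, sin_intCast_mul_pi, neg_zero, zero_mul] at h
    exact h
  have hsin : HasDerivAt (fun m : ℂ => Complex.sin (m * Real.pi))
      (Complex.cos (n * Real.pi) * Real.pi) (n : ℂ) := by
    have h := ((hasDerivAt_id (n : ℂ)).mul_const (Real.pi : ℂ)).csin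
    simp only [id, one_mul] at h
    exact h
  have hneg : HasDerivAt (fun m => logJ (-m) τ) (-logJOrder (-(n : ℂ)) τ) (n : ℂ) := by
    have := (hasDerivAt_logJ_order (-(n : ℂ)) τ).comp (n : ℂ) (hasDerivAt_neg (n : ℂ))
    exact this.congr_deriv (by ring)
  have hnum := ((hasDerivAt_logJ_order (n : ℂ) τ).fun_mul hcos).fun_sub hneg
  have hc := cos_intCast_mul_pi_sq n
  have hc0 : Complex.cos (n * Real.pi) ≠ 0 := by
    intro h
    rw [h] at hc
    norm_num at hc
  have hlim := (hasDerivAt_iff_tendsto_slope.1 hnum).div (hasDerivAt_iff_tendsto_slope.1 hsin)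
    (mul_ne_zero hc0 hpi)
  have hval : (logJOrder n τ * Complex.cos (n * Real.pi) + logJ n τ * 0 - -logJOrder (-(n : ℂ)) τ) /
      (Complex.cos (n * Real.pi) * Real.pi) = logY n τ := by
    rw [logY, if_pos ⟨n, rfl⟩]
    field_simp
    linear_combination (-logJOrder (-(n : ℂ)) τ) * hc
  rw [hval] at hlim
  refine hlim.congr' ?_
  filter_upwards [self_mem_nhdsWithin] with m hm
  have hm' : m - n ≠ 0 := sub_ne_zero.2 hm
  rw [Pi.div_apply, slope_def_field, slope_def_field, sin_intCast_mul_pi, logJ_neg_intCast,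
    besselYQuot, besselJ_eq_logJ m hz, besselJ_eq_logJ (-m) hz, div_div_div_cancel_right₀ hm',
    mul_comm (logJ (n : ℂ) τ), sub_self, sub_zero, sub_zero]

theorem besselY_eq_logY (μ : ℂ) {z : ℂ} (hz : z ≠ 0) :
    besselY μ z = logY μ (Complex.log z) := by
  by_cases h : ∃ n : ℤ, μ = n
  · rw [besselY, if_pos h]
    obtain ⟨n, rfl⟩ := h
    exact (tendsto_besselYQuot n hz).limUnder_eq
  · rw [besselY, if_neg h, logY, if_neg h, besselYQuot, besselJ_eq_logJ μ hz,
      besselJ_eq_logJ (-μ) hz]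

/-- Along the ray through `w` the principal logarithm is `log t + log w`, even if `w` lies on the
cut. So no case distinction is needed there. -/
theorem rayDeriv_of_log {f F : ℂ → ℂ} {F' : ℂ} {w : ℂ} (hw : w ≠ 0)
    (hf : ∀ z, z ≠ 0 → f z = F (Complex.log z)) (hF : HasDerivAt F F' (Complex.log w)) :
    rayDeriv f w = F' / w := by
  unfold rayDeriv
  congr 1
  have h1 : HasDerivAt (fun t : ℝ => ((Real.log t : ℝ) : ℂ) + Complex.log w) 1 1 := by
    have h := ((Real.hasDerivAt_log one_ne_zero).ofReal_comp.add_const (Complex.log w))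
    simpa using h
  have h2 : HasDerivAt F F' (((Real.log 1 : ℝ) : ℂ) + Complex.log w) := by simpa using hF
  have h3 := (h2.comp (1 : ℝ) h1).congr_of_eventuallyEq
    (f₁ := fun t : ℝ => f (t * w)) ?_
  · rw [h3.deriv, mul_one]
  · filter_upwards [lt_mem_nhds (one_pos : (0 : ℝ) < 1)] with t ht
    have ht' : (t : ℂ) ≠ 0 := Complex.ofReal_ne_zero.2 ht.ne'
    rw [hf _ (mul_ne_zero ht' hw), Complex.log_ofReal_mul ht hw]
    rfl

theorem besselJ'_eq (μ : ℂ) {z : ℂ} (hz : z ≠ 0) :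
    besselJ' μ z = logJDeriv μ (Complex.log z) / z :=
  rayDeriv_of_log hz (fun _ h => besselJ_eq_logJ μ h) (hasDerivAt_logJ μ _)

theorem besselY'_eq (μ : ℂ) {z : ℂ} (hz : z ≠ 0) :
    besselY' μ z = logYDeriv μ (Complex.log z) / z :=
  rayDeriv_of_log hz (fun _ h => besselY_eq_logY μ h) (hasDerivAt_logY μ _)

/-! ### Perturbation estimates for `w'' = (q - z²) w`. -/

theorem Complex.norm_exp_mul_I_le (ζ : ℂ) : ‖Complex.exp (ζ * Complex.I)‖ ≤ Real.exp |ζ.im| := by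
  rw [Complex.norm_exp]
  refine Real.exp_le_exp.2 ?_
  simpa using neg_le_abs ζ.im

theorem Complex.norm_exp_neg_mul_I_le (ζ : ℂ) :
    ‖Complex.exp (-ζ * Complex.I)‖ ≤ Real.exp |ζ.im| := by
  simpa using Complex.norm_exp_mul_I_le (-ζ)

theorem Complex.norm_cos_le_exp (ζ : ℂ) : ‖Complex.cos ζ‖ ≤ Real.exp |ζ.im| := by
  rw [Complex.cos, norm_div, Complex.norm_ofNat, div_le_iff₀ two_pos]
  refine (norm_add_le _ _).trans ?_
  linarith [Complex.norm_exp_mul_I_le ζ, Complex.norm_exp_neg_mul_I_le ζ]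

theorem Complex.norm_sin_le_exp (ζ : ℂ) : ‖Complex.sin ζ‖ ≤ Real.exp |ζ.im| := by
  rw [Complex.sin, norm_div, Complex.norm_ofNat, div_le_iff₀ two_pos, norm_mul, Complex.norm_I,
    mul_one]
  refine (norm_sub_le _ _).trans ?_
  linarith [Complex.norm_exp_mul_I_le ζ, Complex.norm_exp_neg_mul_I_le ζ]

theorem Complex.abs_im_mul_ofReal {z : ℂ} {t : ℝ} (ht : 0 ≤ t) :
    |(z * (t : ℂ)).im| = |z.im| * t := by
  rw [Complex.im_mul_ofReal, abs_mul, abs_of_nonneg ht]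

/-- `w'' = (q - z²) w` on `[r, R]`, with `w' = w₁`. -/
structure IsSchrodingerSolution (r R : ℝ) (q : ℝ → ℂ) (z : ℂ) (w w₁ : ℝ → ℂ) : Prop where
  deriv_fst : ∀ t ∈ Set.Icc r R, HasDerivAt w (w₁ t) t
  deriv_snd : ∀ t ∈ Set.Icc r R, HasDerivAt w₁ ((q t - z ^ 2) * w t) t

namespace IsSchrodingerSolution

variable {r R : ℝ} {q : ℝ → ℂ} {z : ℂ} {w w₁ : ℝ → ℂ}

theorem hasDerivAt_mul_sub (z : ℂ) (t s : ℝ) :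
    HasDerivAt (fun s : ℝ => z * ((t - s : ℝ) : ℂ)) (-z) s := by
  have h : HasDerivAt (fun s : ℝ => ((t - s : ℝ) : ℂ)) ((-1 : ℝ) : ℂ) s :=
    ((hasDerivAt_id s).const_sub t).ofReal_comp
  exact (h.const_mul z).congr_deriv (by push_cast; ring)

/-- Variation of constants. Transport the data at time `s` freely to time `t`: the result is the
free solution for `s = r` and the true one for `s = t`. Its `s`-derivative contains only `q w`, and
the mean value inequality bounds the difference. -/
theorem norm_sub_le (h : IsSchrodingerSolution r R q z w w₁) (hz : z ≠ 0) {Q m : ℝ}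
    (hq : ∀ t ∈ Set.Icc r R, ‖q t‖ ≤ Q)
    (hm : ∀ t ∈ Set.Icc r R, ‖w t‖ ≤ m * Real.exp (|z.im| * (t - r)))
    {t : ℝ} (ht : t ∈ Set.Icc r R) :
    ‖w t - (Complex.cos (z * (t - r : ℝ)) * w r + Complex.sin (z * (t - r : ℝ)) / z * w₁ r)‖ ≤
      Q * m / ‖z‖ * Real.exp (|z.im| * (t - r)) * (t - r) ∧
    ‖w₁ t - (-z * Complex.sin (z * (t - r : ℝ)) * w r + Complex.cos (z * (t - r : ℝ)) * w₁ r)‖ ≤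
      Q * m * Real.exp (|z.im| * (t - r)) * (t - r) := by
  have hz' : 0 < ‖z‖ := norm_pos_iff.2 hz
  have hsub : ∀ s ∈ Set.Icc r t, s ∈ Set.Icc r R := fun s hs => ⟨hs.1, hs.2.trans ht.2⟩
  have hkey : ∀ s ∈ Set.Icc r t, ∀ ζ : ℂ, ‖ζ‖ ≤ Real.exp (|z.im| * (t - s)) →
      ‖ζ * (q s * w s)‖ ≤ Q * m * Real.exp (|z.im| * (t - r)) := by
    intro s hs ζ hζ
    have h1 := hq s (hsub s hs)
    have h2 := hm s (hsub s hs)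
    have h3 : Real.exp (|z.im| * (t - r)) =
        Real.exp (|z.im| * (t - s)) * Real.exp (|z.im| * (s - r)) := by
      rw [← Real.exp_add]
      ring_nf
    rw [norm_mul, norm_mul]
    calc ‖ζ‖ * (‖q s‖ * ‖w s‖) ≤ Real.exp (|z.im| * (t - s)) *
          (Q * (m * Real.exp (|z.im| * (s - r)))) := by
          have := (norm_nonneg _).trans h1
          gcongr
      _ = _ := by rw [h3]; ring
  have hcos : ∀ s : ℝ, HasDerivAt (fun s : ℝ => Complex.cos (z * (t - s : ℝ)))
      (z * Complex.sin (z * (t - s : ℝ))) s := fun s =>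
    ((Complex.hasDerivAt_cos _).comp s (hasDerivAt_mul_sub z t s)).congr_deriv (by ring)
  have hsin : ∀ s : ℝ, HasDerivAt (fun s : ℝ => Complex.sin (z * (t - s : ℝ)))
      (-z * Complex.cos (z * (t - s : ℝ))) s := fun s =>
    ((Complex.hasDerivAt_sin _).comp s (hasDerivAt_mul_sub z t s)).congr_deriv (by ring)
  constructor
  · have hd : ∀ s ∈ Set.Icc r t, HasDerivWithinAt
        (fun s : ℝ => Complex.cos (z * (t - s : ℝ)) * w s + Complex.sin (z * (t - s : ℝ)) / z * w₁ s)
        (Complex.sin (z * (t - s : ℝ)) * (q s * w s) / z) (Set.Icc r t) s := by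
      intro s hs
      refine ((((hcos s).mul (h.deriv_fst s (hsub s hs))).add
        (((hsin s).div_const z).mul (h.deriv_snd s (hsub s hs)))).congr_deriv ?_).hasDerivWithinAt
      field_simp
      ring
    have hb : ∀ s ∈ Set.Ico r t, ‖Complex.sin (z * (t - s : ℝ)) * (q s * w s) / z‖ ≤
        Q * m / ‖z‖ * Real.exp (|z.im| * (t - r)) := by
      intro s hs
      have hs' : s ∈ Set.Icc r t := Set.Ico_subset_Icc_self hs
      rw [norm_div, div_mul_eq_mul_div]
      refine div_le_div_of_nonneg_right (hkey s hs' _ ?_) hz'.le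
      rw [← Complex.abs_im_mul_ofReal (sub_nonneg.2 hs'.2)]
      exact Complex.norm_sin_le_exp _
    simpa using norm_image_sub_le_of_norm_deriv_le_segment' hd hb t ⟨ht.1, le_rfl⟩
  · have hd : ∀ s ∈ Set.Icc r t, HasDerivWithinAt
        (fun s : ℝ => -z * Complex.sin (z * (t - s : ℝ)) * w s + Complex.cos (z * (t - s : ℝ)) * w₁ s)
        (Complex.cos (z * (t - s : ℝ)) * (q s * w s)) (Set.Icc r t) s := by
      intro s hs
      refine (((((hsin s).const_mul (-z)).mul (h.deriv_fst s (hsub s hs))).add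
        ((hcos s).mul (h.deriv_snd s (hsub s hs)))).congr_deriv ?_).hasDerivWithinAt
      ring
    have hb : ∀ s ∈ Set.Ico r t, ‖Complex.cos (z * (t - s : ℝ)) * (q s * w s)‖ ≤
        Q * m * Real.exp (|z.im| * (t - r)) := by
      intro s hs
      have hs' : s ∈ Set.Icc r t := Set.Ico_subset_Icc_self hs
      refine hkey s hs' _ ?_
      rw [← Complex.abs_im_mul_ofReal (sub_nonneg.2 hs'.2)]
      exact Complex.norm_cos_le_exp _
    simpa using norm_image_sub_le_of_norm_deriv_le_segment' hd hb t ⟨ht.1, le_rfl⟩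

/-- Let `m` be the maximum of `|w| e^{-|Im z|(t-r)}`. At a maximum point, `norm_sub_le` gives `m ≤
(initial data) + m/2`; the hypothesis `2Q(R-r) ≤ |z|` provides the factor `1/2`. -/
theorem norm_le (h : IsSchrodingerSolution r R q z w w₁) (hrR : r ≤ R) (hz : z ≠ 0) {Q : ℝ}
    (hq : ∀ t ∈ Set.Icc r R, ‖q t‖ ≤ Q) (hQ : 2 * Q * (R - r) ≤ ‖z‖)
    {t : ℝ} (ht : t ∈ Set.Icc r R) :
    ‖w t‖ ≤ 2 * (‖w r‖ + ‖w₁ r‖ / ‖z‖) * Real.exp (|z.im| * (t - r)) := by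
  have hz' : 0 < ‖z‖ := norm_pos_iff.2 hz
  have hcont : ContinuousOn (fun t => ‖w t‖ / Real.exp (|z.im| * (t - r))) (Set.Icc r R) := by
    refine ContinuousOn.div ?_ (by fun_prop) fun t _ => (Real.exp_pos _).ne'
    exact fun t ht => (h.deriv_fst t ht).continuousAt.norm.continuousWithinAt
  obtain ⟨t₀, ht₀, hmax⟩ := isCompact_Icc.exists_isMaxOn (Set.nonempty_Icc.2 hrR) hcont
  set m := ‖w t₀‖ / Real.exp (|z.im| * (t₀ - r)) with hmdef
  have hm : ∀ t ∈ Set.Icc r R, ‖w t‖ ≤ m * Real.exp (|z.im| * (t - r)) := by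
    intro t ht
    exact (div_le_iff₀ (Real.exp_pos _)).1 (hmax ht)
  have hm0 : 0 ≤ m := by positivity
  have hQ0 : 0 ≤ Q := (norm_nonneg _).trans (hq t ht)
  set E := Real.exp (|z.im| * (t₀ - r)) with hE
  have hEpos : 0 < E := Real.exp_pos _
  have h1 := (h.norm_sub_le hz hq hm ht₀).1
  have hle : 0 ≤ t₀ - r := sub_nonneg.2 ht₀.1
  have hs : ‖Complex.sin (z * (t₀ - r : ℝ))‖ ≤ E := by
    rw [hE, ← Complex.abs_im_mul_ofReal hle]
    exact Complex.norm_sin_le_exp _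
  have hc : ‖Complex.cos (z * (t₀ - r : ℝ))‖ ≤ E := by
    rw [hE, ← Complex.abs_im_mul_ofReal hle]
    exact Complex.norm_cos_le_exp _
  have h2 : ‖Complex.cos (z * (t₀ - r : ℝ)) * w r + Complex.sin (z * (t₀ - r : ℝ)) / z * w₁ r‖ ≤
      E * (‖w r‖ + ‖w₁ r‖ / ‖z‖) := by
    refine (norm_add_le _ _).trans ?_
    rw [norm_mul, norm_mul, norm_div]
    calc _ ≤ E * ‖w r‖ + E / ‖z‖ * ‖w₁ r‖ := by gcongr
      _ = _ := by ring
  have h3 : Q * m / ‖z‖ * E * (t₀ - r) ≤ m / 2 * E := by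
    have : Q * (t₀ - r) ≤ ‖z‖ / 2 := by nlinarith [ht₀.2]
    calc Q * m / ‖z‖ * E * (t₀ - r) = (Q * (t₀ - r)) * (m * E / ‖z‖) := by ring
      _ ≤ ‖z‖ / 2 * (m * E / ‖z‖) := by gcongr
      _ = m / 2 * E := by field_simp
  have h4 : ‖w t₀‖ = m * E := by
    rw [hmdef]
    field_simp
  have h5 : m * E ≤ (‖w r‖ + ‖w₁ r‖ / ‖z‖ + m / 2) * E := by
    rw [← h4]
    calc ‖w t₀‖ ≤ _ := norm_le_norm_add_norm_sub' _ _
      _ ≤ E * (‖w r‖ + ‖w₁ r‖ / ‖z‖) + m / 2 * E := add_le_add h2 (h1.trans h3)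
      _ = _ := by ring
  have h6 : m ≤ 2 * (‖w r‖ + ‖w₁ r‖ / ‖z‖) := by
    have := le_of_mul_le_mul_right h5 hEpos
    linarith
  exact (hm t ht).trans (by gcongr)

/-- The free term `cos(z(R-r)) w₁(r)` is counted as error, because it lacks the factor `z` of the
main term. -/
theorem norm_deriv_sub_le (h : IsSchrodingerSolution r R q z w w₁) (hrR : r ≤ R) (hz : z ≠ 0)
    {Q : ℝ} (hq : ∀ t ∈ Set.Icc r R, ‖q t‖ ≤ Q) (hQ : 2 * Q * (R - r) ≤ ‖z‖) :
    ‖w₁ R - -z * Complex.sin (z * (R - r : ℝ)) * w r‖ ≤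
      (‖w₁ r‖ + 2 * Q * (R - r) * (‖w r‖ + ‖w₁ r‖ / ‖z‖)) * Real.exp (|z.im| * (R - r)) := by
  have h1 := (h.norm_sub_le hz hq (fun t ht => h.norm_le hrR hz hq hQ ht)
    (Set.right_mem_Icc.2 hrR)).2
  have hc : ‖Complex.cos (z * (R - r : ℝ))‖ ≤ Real.exp (|z.im| * (R - r)) := by
    rw [← Complex.abs_im_mul_ofReal (sub_nonneg.2 hrR)]
    exact Complex.norm_cos_le_exp _
  calc ‖w₁ R - -z * Complex.sin (z * (R - r : ℝ)) * w r‖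
      = ‖(w₁ R - (-z * Complex.sin (z * (R - r : ℝ)) * w r
          + Complex.cos (z * (R - r : ℝ)) * w₁ r)) + Complex.cos (z * (R - r : ℝ)) * w₁ r‖ := by
        congr 1
        ring
    _ ≤ _ := norm_add_le _ _
    _ ≤ Q * (2 * (‖w r‖ + ‖w₁ r‖ / ‖z‖)) * Real.exp (|z.im| * (R - r)) * (R - r)
        + Real.exp (|z.im| * (R - r)) * ‖w₁ r‖ := by
        rw [norm_mul]
        gcongr
    _ = _ := by ring

end IsSchrodingerSolution

/-! ### The shooting problem: dependence on the parameter, large and small parameters. -/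

/-- `u'' = (ν² - λ e^{2x}) u` with `u' = v` and the initial values `u(a) = 1`, `u'(a) = δ`. -/
structure IsShooting (a ν δ : ℝ) (l : ℂ) (u v : ℝ → ℂ) : Prop where
  deriv_fst : ∀ x, HasDerivAt u (v x) x
  deriv_snd : ∀ x : ℝ, HasDerivAt v (((ν : ℂ) ^ 2 - l * (Real.exp x : ℂ) ^ 2) * u x) x
  init_fst : u a = 1
  init_snd : v a = δ

namespace IsShooting

variable {a ν δ : ℝ}

/-- Grönwall's inequality for the difference of two solutions, with a constant uniform in `l` near
`l₀`. The case `l = l₀` is uniqueness; `l₀ = 0` controls the cross-product near `z = 0`. -/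
theorem exists_norm_sub_le {l₀ : ℂ} {u₀ v₀ : ℝ → ℂ} (h₀ : IsShooting a ν δ l₀ u₀ v₀)
    (a' : ℝ) :
    ∃ K : ℝ, ∀ l : ℂ, ‖l‖ ≤ ‖l₀‖ + 1 → ∀ u v : ℝ → ℂ, IsShooting a ν δ l u v →
      ∀ x ∈ Set.Icc a a', ‖u x - u₀ x‖ ≤ K * ‖l - l₀‖ ∧ ‖v x - v₀ x‖ ≤ K * ‖l - l₀‖ := by
  obtain ⟨M, hM⟩ := (isCompact_Icc (a := a) (b := a')).exists_bound_of_continuousOn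
    (f := u₀) (fun x _ => (h₀.deriv_fst x).continuousAt.continuousWithinAt)
  set P : ℝ := 1 + ν ^ 2 + (‖l₀‖ + 1) * Real.exp a' ^ 2 with hP
  have hPpos : 0 < P := by positivity
  set ε : ℝ := Real.exp a' ^ 2 * M
  refine ⟨ε / P * (Real.exp (P * (a' - a)) - 1), fun l hl u v h x hx => ?_⟩
  let f : ℝ → ℂ × ℂ := fun x => (u x - u₀ x, v x - v₀ x)
  let f' : ℝ → ℂ × ℂ := fun x => (v x - v₀ x,
    ((ν : ℂ) ^ 2 - l * (Real.exp x : ℂ) ^ 2) * u x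
      - ((ν : ℂ) ^ 2 - l₀ * (Real.exp x : ℂ) ^ 2) * u₀ x)
  have hf : ∀ x, HasDerivAt f (f' x) x := fun x =>
    ((h.deriv_fst x).sub (h₀.deriv_fst x)).prodMk ((h.deriv_snd x).sub (h₀.deriv_snd x))
  have hfa : ‖f a‖ ≤ 0 := by
    simp [f, h.init_fst, h₀.init_fst, h.init_snd, h₀.init_snd]
  have hM0 : 0 ≤ M := (norm_nonneg _).trans (hM x hx)
  have hbound : ∀ x ∈ Set.Ico a a', ‖f' x‖ ≤ P * ‖f x‖ + ‖l - l₀‖ * ε := by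
    intro x hx
    have hexp : Real.exp x ≤ Real.exp a' := Real.exp_le_exp.2 hx.2.le
    have h1 : ‖u x - u₀ x‖ ≤ ‖f x‖ := norm_fst_le (f x)
    have h2 : ‖v x - v₀ x‖ ≤ ‖f x‖ := norm_snd_le (f x)
    have hMx := hM x ⟨hx.1, hx.2.le⟩
    refine max_le ?_ ?_
    · calc ‖v x - v₀ x‖ ≤ 1 * ‖f x‖ := by rw [one_mul]; exact h2
        _ ≤ P * ‖f x‖ := by
          gcongr
          rw [hP, add_assoc]
          exact le_add_of_nonneg_right (by positivity)
        _ ≤ _ := le_add_of_nonneg_right (by positivity)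
    · have hnE : ‖(Real.exp x : ℂ) ^ 2‖ = Real.exp x ^ 2 := by
        rw [norm_pow, Complex.norm_real, Real.norm_eq_abs, abs_of_pos (Real.exp_pos x)]
      have hnν : ‖(ν : ℂ) ^ 2‖ = ν ^ 2 := by
        rw [norm_pow, Complex.norm_real, Real.norm_eq_abs, sq_abs]
      calc ‖((ν : ℂ) ^ 2 - l * (Real.exp x : ℂ) ^ 2) * u x
            - ((ν : ℂ) ^ 2 - l₀ * (Real.exp x : ℂ) ^ 2) * u₀ x‖
          = ‖(ν : ℂ) ^ 2 * (u x - u₀ x) - l * (Real.exp x : ℂ) ^ 2 * (u x - u₀ x)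
            - (l - l₀) * ((Real.exp x : ℂ) ^ 2 * u₀ x)‖ := by
            congr 1
            ring
        _ ≤ ‖(ν : ℂ) ^ 2 * (u x - u₀ x)‖ + ‖l * (Real.exp x : ℂ) ^ 2 * (u x - u₀ x)‖
            + ‖(l - l₀) * ((Real.exp x : ℂ) ^ 2 * u₀ x)‖ :=
            (norm_sub_le _ _).trans (add_le_add_left (norm_sub_le _ _) _)
        _ = ν ^ 2 * ‖u x - u₀ x‖ + ‖l‖ * Real.exp x ^ 2 * ‖u x - u₀ x‖
            + ‖l - l₀‖ * (Real.exp x ^ 2 * ‖u₀ x‖) := by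
            rw [norm_mul, norm_mul, norm_mul, norm_mul, norm_mul, hnE, hnν]
        _ ≤ ν ^ 2 * ‖f x‖ + (‖l₀‖ + 1) * Real.exp a' ^ 2 * ‖f x‖
            + ‖l - l₀‖ * (Real.exp a' ^ 2 * M) := by gcongr
        _ ≤ P * ‖f x‖ + ‖l - l₀‖ * ε := by
            have := norm_nonneg (f x)
            rw [hP]
            simp only [ε]
            linarith
  have hmain := norm_le_gronwallBound_of_norm_deriv_right_le
    (fun x _ => (hf x).continuousAt.continuousWithinAt)
    (fun x _ => (hf x).hasDerivWithinAt) hfa hbound x hx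
  rw [gronwallBound_of_K_ne_0 hPpos.ne'] at hmain
  have hfin : ‖f x‖ ≤ ε / P * (Real.exp (P * (a' - a)) - 1) * ‖l - l₀‖ := by
    refine hmain.trans ?_
    have : Real.exp (P * (x - a)) ≤ Real.exp (P * (a' - a)) := by
      refine Real.exp_le_exp.2 ?_
      have := hx.2
      gcongr
    calc 0 * Real.exp (P * (x - a)) + ‖l - l₀‖ * ε / P * (Real.exp (P * (x - a)) - 1)
        ≤ ‖l - l₀‖ * ε / P * (Real.exp (P * (a' - a)) - 1) := by
          rw [zero_mul, zero_add]
          gcongr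
      _ = _ := by ring
  exact ⟨(norm_fst_le (f x)).trans hfin, (norm_snd_le (f x)).trans hfin⟩

theorem unique {l : ℂ} {u v u' v' : ℝ → ℂ} (h : IsShooting a ν δ l u v)
    (h' : IsShooting a ν δ l u' v') {x : ℝ} (hx : a ≤ x) : u x = u' x ∧ v x = v' x := by
  obtain ⟨K, hK⟩ := h'.exists_norm_sub_le x
  have := hK l (by linarith) u v h x ⟨hx, le_rfl⟩
  simp only [sub_self, norm_zero, mul_zero, norm_le_zero_iff, sub_eq_zero] at this
  exact this

end IsShooting

namespace IsShooting

variable {a ν δ : ℝ}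

/-- Liouville's substitution `t = e^x`: the factor `√t` removes the first-order term, and for `a =
log r` the normalization makes `w(r) = 1`. -/
theorem isSchrodingerSolution {r R : ℝ} (hr : 0 < r) {z : ℂ} {u v : ℝ → ℂ}
    (h : IsShooting a ν δ (z ^ 2) u v) :
    IsSchrodingerSolution r R (fun t => (((ν ^ 2 - 1 / 4) / t ^ 2 : ℝ) : ℂ)) z
      (fun t => Real.exp ((Real.log t - a) / 2) * u (Real.log t))
      (fun t => Real.exp ((Real.log t - a) / 2) * (u (Real.log t) / 2 + v (Real.log t)) / t) := by
  have hE : ∀ t : ℝ, 0 < t → HasDerivAt (fun t : ℝ => (Real.exp ((Real.log t - a) / 2) : ℂ))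
      (Real.exp ((Real.log t - a) / 2) / (2 * t)) t := by
    intro t ht
    refine ((((Real.hasDerivAt_log ht.ne').sub_const a).div_const 2).exp.ofReal_comp).congr_deriv ?_
    push_cast
    field_simp
  have hcomp : ∀ {f : ℝ → ℂ} {f' : ℂ} {t : ℝ}, 0 < t → HasDerivAt f f' (Real.log t) →
      HasDerivAt (fun t => f (Real.log t)) (f' / t) t := by
    intro f f' t ht hf
    refine (hf.scomp t (Real.hasDerivAt_log ht.ne')).congr_deriv ?_
    rw [Complex.real_smul]
    push_cast
    ring
  constructor
  · intro t ht
    have ht0 : 0 < t := hr.trans_le ht.1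
    have htc : (t : ℂ) ≠ 0 := Complex.ofReal_ne_zero.2 ht0.ne'
    refine ((hE t ht0).mul (hcomp ht0 (h.deriv_fst _))).congr_deriv ?_
    field_simp
  · intro t ht
    have ht0 : 0 < t := hr.trans_le ht.1
    have htc : (t : ℂ) ≠ 0 := Complex.ofReal_ne_zero.2 ht0.ne'
    have hid : HasDerivAt (fun t : ℝ => (t : ℂ)) ((1 : ℝ) : ℂ) t := (hasDerivAt_id t).ofReal_comp
    have h1 := ((hcomp ht0 (h.deriv_fst _)).div_const 2).add (hcomp ht0 (h.deriv_snd _))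
    refine ((((hE t ht0).mul h1).div hid htc)).congr_deriv ?_
    rw [Real.exp_log ht0]
    simp only [Pi.mul_apply, Pi.add_apply]
    push_cast
    field_simp
    ring

theorem exists_asymptotic {r R : ℝ} (hr : 0 < r) (hrR : r < R) (δ : ℝ) :
    ∃ C : ℝ, 0 < C ∧ ∀ (ν : ℝ) (z : ℂ), C * (ν ^ 2 + 1) ≤ ‖z‖ → ∀ u v : ℝ → ℂ,
      IsShooting (Real.log r) ν δ (z ^ 2) u v →
      ‖Real.exp ((Real.log R - Real.log r) / 2) * (v (Real.log R) - δ * u (Real.log R))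
        - -R * (z * Complex.sin (z * (R - r : ℝ)))‖ <
        R * ‖z‖ * (Real.exp (|z.im| * (R - r)) / 8) := by
  have hR : 0 < R := hr.trans hrR
  have hL : 0 < R - r := sub_pos.2 hrR
  set c₁ : ℝ := |(1 / 2 + δ) / r| with hc₁
  set C₁ : ℝ := R * c₁ + 2 * R * (R - r) * (1 + c₁) / r ^ 2 + 2 * |1 / 2 + δ| * (1 + c₁) with hC₁
  have hc₁0 : 0 ≤ c₁ := abs_nonneg _
  have hC₁0 : 0 ≤ C₁ := by positivity
  -- The three summands secure `|z| ≥ 1`, the smallness `2Q(R-r) ≤ |z|`, and a total error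
  -- `C₁(ν²+1)e^{|Im z|(R-r)}` below the target. Here `c₁` is `|w'(r)|`.
  refine ⟨1 + 2 * (R - r) / r ^ 2 + 8 * C₁ / R, by positivity, fun ν z hz u v h => ?_⟩
  have hν : 1 ≤ ν ^ 2 + 1 := by nlinarith [sq_nonneg ν]
  set Q : ℝ := (ν ^ 2 + 1) / r ^ 2 with hQ
  have hz1 : 1 ≤ ‖z‖ := by
    refine le_trans ?_ hz
    have : 0 ≤ 2 * (R - r) / r ^ 2 + 8 * C₁ / R := by positivity
    nlinarith
  have hz0 : 0 < ‖z‖ := one_pos.trans_le hz1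
  have hz2 : 2 * Q * (R - r) ≤ ‖z‖ := by
    refine le_trans ?_ hz
    calc 2 * Q * (R - r) = 2 * (R - r) / r ^ 2 * (ν ^ 2 + 1) := by rw [hQ]; ring
      _ ≤ _ := by
        gcongr
        have : 0 ≤ 8 * C₁ / R := by positivity
        linarith
  have hz3 : C₁ * (ν ^ 2 + 1) < R * ‖z‖ / 8 := by
    have h1 : (1 + 8 * C₁ / R) * (ν ^ 2 + 1) ≤ ‖z‖ := by
      refine le_trans ?_ hz
      gcongr
      have : 0 ≤ 2 * (R - r) / r ^ 2 := by positivity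
      linarith
    have h2 : R * ((1 + 8 * C₁ / R) * (ν ^ 2 + 1)) / 8 =
        R / 8 * (ν ^ 2 + 1) + C₁ * (ν ^ 2 + 1) := by field_simp
    have h3 : R * ((1 + 8 * C₁ / R) * (ν ^ 2 + 1)) / 8 ≤ R * ‖z‖ / 8 := by gcongr
    have : 0 < R / 8 * (ν ^ 2 + 1) := by positivity
    linarith
  have hzne : z ≠ 0 := norm_pos_iff.1 hz0
  have hsol := h.isSchrodingerSolution (R := R) hr
  have hq : ∀ t ∈ Set.Icc r R, ‖(((ν ^ 2 - 1 / 4) / t ^ 2 : ℝ) : ℂ)‖ ≤ Q := by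
    intro t ht
    have ht0 : 0 < t := hr.trans_le ht.1
    rw [Complex.norm_real, Real.norm_eq_abs, abs_div, abs_of_pos (pow_pos ht0 2), hQ]
    have h1 : |ν ^ 2 - 1 / 4| ≤ ν ^ 2 + 1 := by
      rw [abs_le]
      constructor <;> nlinarith [sq_nonneg ν]
    have h2 := ht.1
    gcongr
  have hw := hsol.norm_le hrR.le hzne hq hz2 (Set.right_mem_Icc.2 hrR.le)
  have hw₁ := hsol.norm_deriv_sub_le hrR.le hzne hq hz2
  have hwr : (Real.exp ((Real.log r - Real.log r) / 2) : ℂ) * u (Real.log r) = 1 := by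
    simp [h.init_fst]
  have hw₁r : ‖(Real.exp ((Real.log r - Real.log r) / 2) : ℂ) *
      (u (Real.log r) / 2 + v (Real.log r)) / r‖ = c₁ := by
    rw [h.init_fst, h.init_snd, sub_self, zero_div, Real.exp_zero, Complex.ofReal_one, one_mul, hc₁,
      ← Real.norm_eq_abs, ← Complex.norm_real]
    push_cast
    rfl
  simp only [hwr, hw₁r, norm_one, mul_one] at hw hw₁
  set E := Real.exp (|z.im| * (R - r))
  set κ : ℂ := (Real.exp ((Real.log R - Real.log r) / 2) : ℂ)
  have hEpos : 0 < E := Real.exp_pos _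
  have hRc : (R : ℂ) ≠ 0 := Complex.ofReal_ne_zero.2 hR.ne'
  have hm : 1 + c₁ / ‖z‖ ≤ 1 + c₁ := by
    gcongr
    exact div_le_self hc₁0 hz1
  -- In terms of `w`, the endpoint quantity is `R w'(R) - (1/2 + δ) w(R)`.
  calc ‖κ * (v (Real.log R) - δ * u (Real.log R)) - -R * (z * Complex.sin (z * (R - r : ℝ)))‖
      = ‖R * (κ * (u (Real.log R) / 2 + v (Real.log R)) / R - -z * Complex.sin (z * (R - r : ℝ)))
        - ((1 / 2 + δ : ℝ) : ℂ) * (κ * u (Real.log R))‖ := by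
        congr 1
        push_cast
        field_simp
        ring
    _ ≤ R * ‖κ * (u (Real.log R) / 2 + v (Real.log R)) / R - -z * Complex.sin (z * (R - r : ℝ))‖
        + |1 / 2 + δ| * ‖κ * u (Real.log R)‖ := by
        refine (norm_sub_le _ _).trans_eq ?_
        rw [norm_mul, norm_mul (((1 / 2 + δ : ℝ) : ℂ)), Complex.norm_real, Complex.norm_real,
          Real.norm_eq_abs, Real.norm_eq_abs, abs_of_pos hR]
    _ ≤ R * ((c₁ + 2 * Q * (R - r) * (1 + c₁)) * E) + |1 / 2 + δ| * (2 * (1 + c₁) * E) := by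
        refine add_le_add (mul_le_mul_of_nonneg_left (hw₁.trans ?_) hR.le)
          (mul_le_mul_of_nonneg_left (hw.trans ?_) (abs_nonneg _))
        · gcongr
        · gcongr
    _ = (R * c₁ * 1 + 2 * R * (R - r) * (1 + c₁) / r ^ 2 * (ν ^ 2 + 1)
        + 2 * |1 / 2 + δ| * (1 + c₁) * 1) * E := by
        rw [hQ]
        ring
    _ ≤ (R * c₁ * (ν ^ 2 + 1) + 2 * R * (R - r) * (1 + c₁) / r ^ 2 * (ν ^ 2 + 1)
        + 2 * |1 / 2 + δ| * (1 + c₁) * (ν ^ 2 + 1)) * E := by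
        gcongr
    _ = C₁ * (ν ^ 2 + 1) * E := by
        rw [hC₁]
        ring
    _ < R * ‖z‖ / 8 * E := by gcongr
    _ = _ := by ring

/-- For `l = 0` the equation is `u'' = ν² u`. The endpoint value is `(ν² - δ²) sinh(ν(b-a))/ν`, or
`-δ²(b-a)` when `ν = 0`. -/
theorem exists_isShooting_zero {b : ℝ} (hab : a < b) (hν : 0 ≤ ν) (hνδ : ν ≠ |δ|) :
    ∃ u v : ℝ → ℂ, IsShooting a ν δ 0 u v ∧ v b - δ * u b ≠ 0 := by
  rcases hν.eq_or_lt with rfl | hν0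
  · have hδ : δ ≠ 0 := by
      rintro rfl
      simp at hνδ
    refine ⟨fun x => ((1 + δ * (x - a) : ℝ) : ℂ), fun _ => (δ : ℂ), ⟨fun x => ?_, fun x => ?_,
      by simp, rfl⟩, ?_⟩
    · have := ((((hasDerivAt_id x).sub_const a).const_mul δ).const_add 1).ofReal_comp
      simpa using this
    · simpa using hasDerivAt_const x (δ : ℂ)
    · rw [← Complex.ofReal_mul, ← Complex.ofReal_sub, Complex.ofReal_ne_zero]
      have : δ - δ * (1 + δ * (b - a)) = -(δ ^ 2 * (b - a)) := by ring
      rw [this]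
      exact neg_ne_zero.2 (mul_ne_zero (pow_ne_zero 2 hδ) (sub_pos.2 hab).ne')
  · have hlin : ∀ x : ℝ, HasDerivAt (fun x => ν * (x - a)) ν x := fun x => by
      simpa using ((hasDerivAt_id x).sub_const a).const_mul ν
    refine ⟨fun x => ((Real.cosh (ν * (x - a)) + δ / ν * Real.sinh (ν * (x - a)) : ℝ) : ℂ),
      fun x => ((ν * Real.sinh (ν * (x - a)) + δ * Real.cosh (ν * (x - a)) : ℝ) : ℂ),
      ⟨fun x => ?_, fun x => ?_, by simp, by simp⟩, ?_⟩
    · have := ((hlin x).cosh.add ((hlin x).sinh.const_mul (δ / ν))).ofReal_comp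
      refine this.congr_deriv ?_
      congr 1
      field_simp
    · have := (((hlin x).sinh.const_mul ν).add ((hlin x).cosh.const_mul δ)).ofReal_comp
      refine this.congr_deriv ?_
      rw [zero_mul, sub_zero, ← Complex.ofReal_pow, ← Complex.ofReal_mul]
      congr 1
      field_simp
    · rw [← Complex.ofReal_mul, ← Complex.ofReal_sub, Complex.ofReal_ne_zero]
      have h1 : ν * Real.sinh (ν * (b - a)) + δ * Real.cosh (ν * (b - a))
          - δ * (Real.cosh (ν * (b - a)) + δ / ν * Real.sinh (ν * (b - a))) =
          (ν ^ 2 - δ ^ 2) / ν * Real.sinh (ν * (b - a)) := by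
        field_simp
        ring
      rw [h1]
      refine mul_ne_zero (div_ne_zero ?_ hν0.ne') (Real.sinh_pos_iff.2 ?_).ne'
      · intro h2
        apply hνδ
        rw [← abs_of_pos hν0]
        exact (sq_eq_sq_iff_abs_eq_abs ν δ).1 (sub_eq_zero.1 h2)
      · exact mul_pos hν0 (sub_pos.2 hab)

theorem isShooting_exp (hνδ : ν = |δ|) : IsShooting a ν δ 0
    (fun x => ((Real.exp (δ * (x - a)) : ℝ) : ℂ))
    (fun x => ((δ * Real.exp (δ * (x - a)) : ℝ) : ℂ)) := by
  have hlin : ∀ x : ℝ, HasDerivAt (fun x => δ * (x - a)) δ x := fun x => by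
    simpa using ((hasDerivAt_id x).sub_const a).const_mul δ
  refine ⟨fun x => ?_, fun x => ?_, by simp, by simp⟩
  · refine ((hlin x).exp.ofReal_comp).congr_deriv ?_
    congr 1
    ring
  · refine (((hlin x).exp.const_mul δ).ofReal_comp).congr_deriv ?_
    rw [zero_mul, sub_zero, ← Complex.ofReal_pow, ← Complex.ofReal_mul, hνδ, sq_abs]
    congr 1
    ring

/-- Lagrange's identity against `u₀ = e^{δ(x-a)}`: the Wronskian `v u₀ - u u₀'` vanishes at `a`, has
derivative `-l e^{2x} u u₀`, and equals `(v - δu) u₀` at `b`. For small `l`, `u` is close to `u₀ >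
0`, so the integral of `e^{2x} u u₀` has real part bounded away from `0`. -/
theorem exists_lower_bound {b : ℝ} (hab : a < b) (hνδ : ν = |δ|) :
    ∃ c : ℝ, 0 < c ∧ ∃ ρ : ℝ, 0 < ρ ∧ ∀ l : ℂ, ‖l‖ ≤ ρ → ∀ u v : ℝ → ℂ,
      IsShooting a ν δ l u v → c * ‖l‖ ≤ ‖v b - δ * u b‖ := by
  have h₀ := isShooting_exp (a := a) hνδ
  obtain ⟨K, hK⟩ := h₀.exists_norm_sub_le b
  set η : ℝ := Real.exp (-(|δ| * (b - a)))
  have hη : 0 < η := Real.exp_pos _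
  have hηle : ∀ x ∈ Set.Icc a b, η ≤ Real.exp (δ * (x - a)) := by
    intro x hx
    refine Real.exp_le_exp.2 ?_
    have h1 : |δ * (x - a)| ≤ |δ| * (b - a) := by
      rw [abs_mul, abs_of_nonneg (sub_nonneg.2 hx.1)]
      gcongr
      exact hx.2
    linarith [(abs_le.1 h1).1]
  set c : ℝ := Real.exp a ^ 2 * (η * (η / 2)) with hc
  have hLpos : 0 < b - a := sub_pos.2 hab
  refine ⟨c * (b - a) / Real.exp (δ * (b - a)), by positivity,
    min 1 (η / (2 * (|K| + 1))), by positivity, fun l hl u v h => ?_⟩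
  rcases eq_or_ne l 0 with rfl | hl0
  · simp
  have hl1 : ‖l‖ ≤ ‖(0 : ℂ)‖ + 1 := by simpa using hl.trans (min_le_left _ _)
  have hl2 : (|K| + 1) * ‖l‖ ≤ η / 2 := by
    have := hl.trans (min_le_right _ _)
    rw [le_div_iff₀ (by positivity)] at this
    linarith
  have hlpos : 0 < ‖l‖ := norm_pos_iff.2 hl0
  set u₀ : ℝ → ℝ := fun x => Real.exp (δ * (x - a))
  have hre : ∀ x ∈ Set.Icc a b, η / 2 ≤ (u x).re := by
    intro x hx
    have h1 := (hK l hl1 u v h x hx).1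
    have h2 : ‖u x - (u₀ x : ℂ)‖ ≤ η / 2 := by
      refine h1.trans (le_trans ?_ hl2)
      rw [sub_zero]
      gcongr
      linarith [le_abs_self K]
    have h3 := (abs_le.1 ((Complex.abs_re_le_norm _).trans h2)).1
    rw [Complex.sub_re, Complex.ofReal_re] at h3
    linarith [hηle x hx]
  let Ψ : ℝ → ℂ := fun x => -(v x * (u₀ x : ℂ) - u x * ((δ * u₀ x : ℝ) : ℂ)) / l
  have hΨ : ∀ x, HasDerivAt Ψ (((Real.exp x ^ 2 * u₀ x : ℝ) : ℂ) * u x) x := by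
    intro x
    refine (((((h.deriv_snd x).mul (h₀.deriv_fst x)).sub
      ((h.deriv_fst x).mul (h₀.deriv_snd x))).neg).div_const l).congr_deriv ?_
    simp only [u₀]
    push_cast
    field_simp
    ring
  have hF : ∀ x, HasDerivAt (fun x => (Ψ x).re) (Real.exp x ^ 2 * u₀ x * (u x).re) x := by
    intro x
    have h1 := (Complex.reCLM.hasFDerivAt.comp_hasDerivAt x (hΨ x))
    refine h1.congr_deriv ?_
    rw [Complex.reCLM_apply, Complex.re_ofReal_mul]
  have hmono := (convex_Icc a b).mul_sub_le_image_sub_of_le_deriv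
    (f := fun x => (Ψ x).re) (C := c)
    (fun x _ => (hF x).continuousAt.continuousWithinAt)
    (fun x _ => (hF x).differentiableAt.differentiableWithinAt)
    (fun x hx => by
      have hx' := interior_subset hx
      rw [(hF x).deriv, hc, mul_assoc]
      have h1 := hre x hx'
      have h2 := hηle x hx'
      have h3 : Real.exp a ≤ Real.exp x := Real.exp_le_exp.2 hx'.1
      gcongr) a (Set.left_mem_Icc.2 hab.le) b (Set.right_mem_Icc.2 hab.le) hab.le
  have hΨa : Ψ a = 0 := by simp [Ψ, u₀, h.init_fst, h.init_snd]
  have hΨb : Ψ b = -((v b - δ * u b) * (u₀ b : ℂ)) / l := by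
    simp only [Ψ]
    push_cast
    ring
  rw [hΨa, Complex.zero_re, sub_zero] at hmono
  have h4 := hmono.trans (Complex.re_le_norm _)
  rw [hΨb, norm_div, norm_neg, norm_mul, Complex.norm_real, Real.norm_eq_abs,
    abs_of_pos (Real.exp_pos _), le_div_iff₀ hlpos] at h4
  rw [div_mul_eq_mul_div, div_le_iff₀ (Real.exp_pos _)]
  exact h4

end IsShooting

/-! ### The model function `z sin(Lz)`. -/

/-- Use `|sin ζ|² = sin² x + sinh² y`. If `|y| ≥ 1`, the hyperbolic sine suffices. If `|y| < 1`,
then `|x|` is within `1` of `(s + 1/2)π`, where `|sin| = 1`, so `|sin x| ≥ 1/2`, while `e^{|y|} ≤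
4`. -/
theorem Complex.exp_abs_im_div_le_norm_sin {s : ℕ} (hs : 1 ≤ s) {ζ : ℂ}
    (hζ : ‖ζ‖ = (s + 1 / 2) * Real.pi) : Real.exp |ζ.im| / 8 ≤ ‖Complex.sin ζ‖ := by
  set x := ζ.re
  set y := ζ.im
  have hsq : ‖Complex.sin ζ‖ ^ 2 = Real.sin x ^ 2 + Real.sinh y ^ 2 := by
    have h1 : Complex.sin ζ = ((Real.sin x * Real.cosh y : ℝ) : ℂ) +
        ((Real.cos x * Real.sinh y : ℝ) : ℂ) * Complex.I := by
      rw [Complex.sin_eq]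
      push_cast
      rfl
    rw [Complex.sq_norm, h1, Complex.normSq_add_mul_I]
    have h2 := Real.cosh_sq y
    have h3 := Real.sin_sq_add_cos_sq x
    linear_combination (Real.sin x) ^ 2 * h2 + Real.sinh y ^ 2 * h3
  have hE : 0 < Real.exp |y| := Real.exp_pos _
  rcases le_or_gt 1 |y| with hy | hy
  · have h1 : |Real.sinh y| ≤ ‖Complex.sin ζ‖ := by
      rw [← abs_of_nonneg (norm_nonneg (Complex.sin ζ)), ← sq_le_sq, hsq]
      nlinarith [sq_nonneg (Real.sin x)]
    refine le_trans ?_ h1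
    rw [Real.abs_sinh, Real.sinh_eq]
    have h2 : Real.exp (-|y|) ≤ 1 := Real.exp_le_one_iff.2 (by linarith)
    have h3 := Real.add_one_le_exp |y|
    linarith
  · have h1 : |Real.sin x| ≤ ‖Complex.sin ζ‖ := by
      rw [← abs_of_nonneg (norm_nonneg (Complex.sin ζ)), ← sq_le_sq, hsq]
      nlinarith [sq_nonneg (Real.sinh y)]
    have h2 : Real.exp |y| ≤ 4 := by
      have := Real.exp_le_exp.2 hy.le
      linarith [Real.exp_one_lt_d9]
    set N : ℝ := (s + 1 / 2) * Real.pi with hN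
    have hs' : (1 : ℝ) ≤ s := by exact_mod_cast hs
    have hN4 : 4 ≤ N := by
      have := Real.pi_gt_three
      nlinarith
    have hxy : N ^ 2 = |x| ^ 2 + |y| ^ 2 := by
      rw [← hζ, Complex.sq_norm, Complex.normSq_apply, sq_abs, sq_abs]
      ring
    have hx0 := abs_nonneg x
    have hy0 := abs_nonneg y
    have hxN : |x| ≤ N := by nlinarith
    set d : ℝ := N - |x| with hd
    have hd0 : 0 ≤ d := sub_nonneg.2 hxN
    have hd1 : d ≤ 1 := by nlinarith
    have hcosN : Real.cos N = 0 := by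
      rw [Real.cos_eq_zero_iff]
      exact ⟨s, by rw [hN]; push_cast; ring⟩
    have hsinN : |Real.sin N| = 1 := by
      have h := Real.sin_sq_add_cos_sq N
      rw [hcosN] at h
      rw [← sq_eq_sq₀ (abs_nonneg _) zero_le_one, sq_abs]
      linarith
    have h3 : |Real.sin x| = |Real.cos d| := by
      have hxd : |x| = N - d := by rw [hd]; ring
      have : |Real.sin x| = |Real.sin (|x|)| := by
        rcases abs_choice x with h | h <;> rw [h]
        rw [Real.sin_neg, abs_neg]
      rw [this, hxd, Real.sin_sub, hcosN, zero_mul, sub_zero, abs_mul, hsinN, one_mul]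
    have h4 : 1 / 2 ≤ Real.cos d := by
      have := Real.one_sub_sq_div_two_le_cos (x := d)
      nlinarith
    have h5 := le_abs_self (Real.cos d)
    linarith

/-- The zeros are `kπ/L` with `|k| ≤ s`, simple except for the double one at `0`. -/
theorem zeroCount_mul_sin {c : ℂ} (hc : c ≠ 0) {L : ℝ} (hL : 0 < L) (s : ℕ) :
    zeroCount (fun z => c * (z * Complex.sin (z * L)))
      (Metric.ball 0 ((s + 1 / 2) * Real.pi / L)) = 2 * s + 2 := by
  have hLc : (L : ℂ) ≠ 0 := Complex.ofReal_ne_zero.2 hL.ne'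
  have hpi : (Real.pi : ℂ) ≠ 0 := Complex.ofReal_ne_zero.2 Real.pi_ne_zero
  have hpos := Real.pi_pos
  classical
  let p : ℤ → ℂ := fun k => (k * Real.pi / L : ℝ)
  have hpk : ∀ k, p k = k * Real.pi / L := fun k => by simp [p]
  have hpinj : Function.Injective p := by
    intro i j hij
    rw [hpk, hpk, div_left_inj' hLc, mul_left_inj' hpi] at hij
    exact_mod_cast hij
  have hnorm : ∀ k, ‖p k‖ = |(k : ℝ)| * Real.pi / L := by
    intro k
    simp only [p]
    rw [Complex.norm_real, Real.norm_eq_abs, abs_div, abs_mul, abs_of_pos hpos, abs_of_pos hL]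
  have hmem : ∀ k, p k ∈ Metric.ball (0 : ℂ) ((s + 1 / 2) * Real.pi / L) ↔
      k ∈ Finset.Icc (-(s : ℤ)) s := by
    intro k
    rw [mem_ball_zero_iff, hnorm, div_lt_div_iff_of_pos_right hL, mul_lt_mul_iff_left₀ hpos,
      Finset.mem_Icc, ← abs_le]
    rw [← Int.cast_abs]
    constructor
    · intro h
      by_contra hlt
      have h1 : (s : ℤ) + 1 ≤ |k| := by omega
      have h2 : ((s : ℝ) + 1) ≤ ((|k| : ℤ) : ℝ) := by exact_mod_cast h1
      linarith
    · intro h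
      have h2 : ((|k| : ℤ) : ℝ) ≤ s := by exact_mod_cast h
      linarith
  have hord : ∀ k, analyticOrderNatAt (fun z => c * (z * Complex.sin (z * L))) (p k) =
      (if k = 0 then 1 else 0) + 1 := by
    intro k
    have hsin : Differentiable ℂ (fun z : ℂ => Complex.sin (z * L)) := by fun_prop
    have h1 : analyticOrderAt (fun z : ℂ => Complex.sin (z * L)) (p k) = 1 := by
      refine (hsin.analyticAt (p k)).analyticOrderAt_eq_one_of_zero_deriv_ne_zero ?_ ?_
      · rw [hpk, div_mul_cancel₀ _ hLc]
        exact Complex.sin_int_mul_pi k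
      · have hd : HasDerivAt (fun z : ℂ => Complex.sin (z * L)) (Complex.cos (p k * L) * L) (p k) := by
          have := ((hasDerivAt_id (p k)).mul_const (L : ℂ)).csin
          simpa using this
        rw [hd.deriv, hpk, div_mul_cancel₀ _ hLc]
        refine mul_ne_zero (fun h => ?_) hLc
        have := cos_intCast_mul_pi_sq k
        rw [h] at this
        norm_num at this
    have h2 : analyticOrderAt (id : ℂ → ℂ) (p k) = if k = 0 then 1 else 0 := by
      by_cases hk : k = 0
      · rw [if_pos hk, hk, show p 0 = 0 by simp [hpk]]
        exact analyticOrderAt_id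
      · rw [if_neg hk]
        refine (analyticAt_id).analyticOrderAt_eq_zero.2 ?_
        rw [id, hpk]
        exact div_ne_zero (mul_ne_zero (Int.cast_ne_zero.2 hk) hpi) hLc
    have h3 : analyticOrderAt (fun _ : ℂ => c) (p k) = 0 :=
      analyticAt_const.analyticOrderAt_eq_zero.2 hc
    have h4 : analyticOrderAt ((fun _ : ℂ => c) * ((id : ℂ → ℂ) *
        (fun z : ℂ => Complex.sin (z * L)))) (p k) = (if k = 0 then 1 else 0) + 1 := by
      rw [analyticOrderAt_mul analyticAt_const (analyticAt_id.mul (hsin.analyticAt _)),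
        analyticOrderAt_mul analyticAt_id (hsin.analyticAt _), h1, h2, h3, zero_add]
    have h5 : (fun z => c * (z * Complex.sin (z * L))) = ((fun _ : ℂ => c) * ((id : ℂ → ℂ) *
        (fun z : ℂ => Complex.sin (z * L)))) := rfl
    rw [analyticOrderNatAt, h5, h4]
    split_ifs <;> rfl
  rw [zeroCount_eq_sum ((Finset.Icc (-(s : ℤ)) s).image p), Finset.sum_image hpinj.injOn,
    Finset.sum_congr rfl fun k _ => hord k, Finset.sum_add_distrib, Finset.sum_ite_eq']
  · simp
    omega
  · intro z hz h
    have h0 := (mul_eq_zero.1 h).resolve_left hc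
    have : ∃ k : ℤ, z = p k := by
      rcases mul_eq_zero.1 h0 with h0 | h0
      · exact ⟨0, by simp [hpk, h0]⟩
      · obtain ⟨k, hk⟩ := Complex.sin_eq_zero_iff.1 h0
        exact ⟨k, by rw [hpk, ← hk, mul_div_cancel_right₀ _ hLc]⟩
    obtain ⟨k, rfl⟩ := this
    exact Finset.mem_image_of_mem p ((hmem k).1 hz)
  · intro z hz
    obtain ⟨k, hk, rfl⟩ := Finset.mem_image.1 hz
    exact (hmem k).2 hk

/-! ### The cross-product as a shooting function, and its entire extension. -/

/-- `(π/2) R r z² 𝔥̃_{ν,δ}(z)` as an entire function of `τ = log z`. -/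
def crossLog (r R ν δ : ℝ) (τ : ℂ) : ℂ :=
  Real.pi / 2 *
    ((logJDeriv ν (Real.log R + τ) - δ * logJ ν (Real.log R + τ)) *
        (logYDeriv ν (Real.log r + τ) - δ * logY ν (Real.log r + τ))
      - (logJDeriv ν (Real.log r + τ) - δ * logJ ν (Real.log r + τ)) *
        (logYDeriv ν (Real.log R + τ) - δ * logY ν (Real.log R + τ)))

theorem differentiable_crossLog (r R ν δ : ℝ) : Differentiable ℂ (crossLog r R ν δ) := by
  have h1 : Differentiable ℂ (logJ ν) := fun τ => (hasDerivAt_logJ ν τ).differentiableAt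
  have h2 : Differentiable ℂ (logJDeriv ν) := fun τ => (hasDerivAt_logJDeriv ν τ).differentiableAt
  have h3 : Differentiable ℂ (logY ν) := fun τ => (hasDerivAt_logY ν τ).differentiableAt
  have h4 : Differentiable ℂ (logYDeriv ν) := fun τ => (hasDerivAt_logYDeriv ν τ).differentiableAt
  unfold crossLog
  fun_prop

theorem hTilde_eq_crossLog {r R : ℝ} (hr : 0 < r) (hR : 0 < R) (ν δ : ℝ) {z : ℂ} (hz : z ≠ 0) :
    hTilde r R ν δ z = 2 / (Real.pi * R * r) * (z ^ 2)⁻¹ * crossLog r R ν δ (Complex.log z) := by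
  have hrc : (r : ℂ) ≠ 0 := Complex.ofReal_ne_zero.2 hr.ne'
  have hRc : (R : ℂ) ≠ 0 := Complex.ofReal_ne_zero.2 hR.ne'
  have hpi : (Real.pi : ℂ) ≠ 0 := Complex.ofReal_ne_zero.2 Real.pi_ne_zero
  have hrz := mul_ne_zero hrc hz
  have hRz := mul_ne_zero hRc hz
  simp only [hTilde, crossG, crossE, crossF, besselJ_eq_logJ _ hrz, besselJ_eq_logJ _ hRz,
    besselY_eq_logY _ hrz, besselY_eq_logY _ hRz, besselJ'_eq _ hrz, besselJ'_eq _ hRz,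
    besselY'_eq _ hrz, besselY'_eq _ hRz, Complex.log_ofReal_mul hr hz,
    Complex.log_ofReal_mul hR hz, crossLog]
  field_simp
  ring

theorem exists_isShooting_crossLog (r R ν δ : ℝ) (τ : ℂ) :
    ∃ u v : ℝ → ℂ, IsShooting (Real.log r) ν δ (Complex.exp τ ^ 2) u v ∧
      crossLog r R ν δ τ = v (Real.log R) - δ * u (Real.log R) := by
  have hpi : (Real.pi : ℂ) ≠ 0 := Complex.ofReal_ne_zero.2 Real.pi_ne_zero
  set P := logYDeriv ν (Real.log r + τ) - δ * logY ν (Real.log r + τ)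
  set Q := logJDeriv ν (Real.log r + τ) - δ * logJ ν (Real.log r + τ)
  have hcomp : ∀ {f : ℂ → ℂ} {f' : ℂ} {x : ℝ}, HasDerivAt f f' (x + τ) →
      HasDerivAt (fun x : ℝ => f (x + τ)) f' x := by
    intro f f' x hf
    exact (hf.comp_add_const (x : ℂ) τ).comp_ofReal
  have hW := logJ_logY_wronskian ν (Real.log r + τ)
  refine ⟨fun x => Real.pi / 2 * (logJ ν (x + τ) * P - logY ν (x + τ) * Q),
    fun x => Real.pi / 2 * (logJDeriv ν (x + τ) * P - logYDeriv ν (x + τ) * Q),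
    ⟨fun x => ?_, fun x => ?_, ?_, ?_⟩, ?_⟩
  · exact (((hcomp (hasDerivAt_logJ ν _)).mul_const P).sub
      ((hcomp (hasDerivAt_logY ν _)).mul_const Q)).const_mul _
  · refine ((((hcomp (hasDerivAt_logJDeriv ν _)).mul_const P).sub
      ((hcomp (hasDerivAt_logYDeriv ν _)).mul_const Q)).const_mul _).congr_deriv ?_
    rw [Complex.exp_add, ← Complex.ofReal_exp]
    ring
  · simp only [P, Q]
    field_simp at hW
    linear_combination hW / 2
  · simp only [P, Q]
    field_simp at hW
    linear_combination δ * hW / 2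
  · simp only [crossLog, P, Q]
    ring

/-- The shooting problem sees `τ` only through `e^{2τ}`, so uniqueness of its solution removes the
monodromy of `J` and `Y`. -/
theorem crossLog_eq_of_exp_eq {r R : ℝ} (hr : 0 < r) (hrR : r < R) (ν δ : ℝ) {τ σ : ℂ}
    (h : Complex.exp τ = Complex.exp σ) : crossLog r R ν δ τ = crossLog r R ν δ σ := by
  obtain ⟨u, v, huv, h1⟩ := exists_isShooting_crossLog r R ν δ τ
  obtain ⟨u', v', huv', h2⟩ := exists_isShooting_crossLog r R ν δ σ
  rw [h] at huv
  obtain ⟨h3, h4⟩ := huv.unique huv' (Real.log_le_log hr hrR.le)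
  rw [h1, h2, h3, h4]

theorem differentiableAt_crossLog_log {r R : ℝ} (hr : 0 < r) (hrR : r < R) (ν δ : ℝ) {z₀ : ℂ}
    (hz₀ : z₀ ≠ 0) : DifferentiableAt ℂ (fun z => crossLog r R ν δ (Complex.log z)) z₀ := by
  -- A rotated branch of the logarithm, holomorphic near `z₀` even on the cut, may replace the
  -- principal one.
  have hev : (fun z => crossLog r R ν δ (Complex.log z)) =ᶠ[𝓝 z₀]
      fun z => crossLog r R ν δ (Complex.log (z / z₀) + Complex.log z₀) := by
    filter_upwards [isOpen_ne.mem_nhds hz₀] with z hz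
    refine crossLog_eq_of_exp_eq hr hrR ν δ ?_
    rw [Complex.exp_add, Complex.exp_log hz, Complex.exp_log (div_ne_zero hz hz₀),
      Complex.exp_log hz₀, div_mul_cancel₀ _ hz₀]
  refine DifferentiableAt.congr_of_eventuallyEq ?_ hev
  refine (differentiable_crossLog r R ν δ _).comp z₀ ?_
  refine DifferentiableAt.add_const _ (DifferentiableAt.clog (by fun_prop) ?_)
  rw [div_self hz₀]
  exact Complex.one_mem_slitPlane

theorem analyticOnNhd_hTilde {r R : ℝ} (hr : 0 < r) (hrR : r < R) (ν δ : ℝ) :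
    AnalyticOnNhd ℂ (hTilde r R ν δ) {0}ᶜ := by
  refine DifferentiableOn.analyticOnNhd (fun z hz => ?_) isOpen_compl_singleton
  have hz' : z ≠ 0 := hz
  have hev : hTilde r R ν δ =ᶠ[𝓝 z] fun z => 2 / (Real.pi * R * r) * (z ^ 2)⁻¹ *
      crossLog r R ν δ (Complex.log z) := by
    filter_upwards [isOpen_ne.mem_nhds hz'] with w hw
    exact hTilde_eq_crossLog hr (hr.trans hrR) ν δ hw
  refine (DifferentiableAt.congr_of_eventuallyEq ?_ hev).differentiableWithinAt
  refine DifferentiableAt.mul ?_ (differentiableAt_crossLog_log hr hrR ν δ hz')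
  have := pow_ne_zero 2 hz'
  fun_prop (disch := assumption)

/-- The entire function `(π/2) R r z² 𝔥̃_{ν,δ}(z)`, with value `d` at `0`. -/
def crossEntire (r R ν δ : ℝ) (d : ℂ) : ℂ → ℂ :=
  Function.update (fun z => crossLog r R ν δ (Complex.log z)) 0 d

theorem crossEntire_of_ne (r R ν δ : ℝ) (d : ℂ) {z : ℂ} (hz : z ≠ 0) :
    crossEntire r R ν δ d z = crossLog r R ν δ (Complex.log z) := Function.update_of_ne hz _ _

theorem crossEntire_zero (r R ν δ : ℝ) (d : ℂ) : crossEntire r R ν δ d 0 = d :=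
  Function.update_self _ _ _

theorem exists_isShooting_crossEntire (r R ν δ : ℝ) (d : ℂ) {z : ℂ} (hz : z ≠ 0) :
    ∃ u v : ℝ → ℂ, IsShooting (Real.log r) ν δ (z ^ 2) u v ∧
      crossEntire r R ν δ d z = v (Real.log R) - δ * u (Real.log R) := by
  rw [crossEntire_of_ne _ _ _ _ _ hz]
  simpa only [Complex.exp_log hz] using exists_isShooting_crossLog r R ν δ (Complex.log z)

/-- With the endpoint value of the `l = 0` problem put in at `0`, this gives continuity there, hence
a removable singularity. -/
theorem exists_norm_crossEntire_sub_le {r R : ℝ} (hr : 0 < r) (hrR : r < R) {ν δ : ℝ}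
    {u₀ v₀ : ℝ → ℂ} (h₀ : IsShooting (Real.log r) ν δ 0 u₀ v₀) :
    ∃ K : ℝ, ∀ z : ℂ, z ≠ 0 → ‖z‖ ≤ 1 →
      ‖crossEntire r R ν δ (v₀ (Real.log R) - δ * u₀ (Real.log R)) z
        - (v₀ (Real.log R) - δ * u₀ (Real.log R))‖ ≤ K * ‖z‖ ^ 2 := by
  obtain ⟨K, hK⟩ := h₀.exists_norm_sub_le (Real.log R)
  refine ⟨(1 + |δ|) * K, fun z hz hz1 => ?_⟩
  obtain ⟨u, v, huv, he⟩ := exists_isShooting_crossEntire r R ν δ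
    (v₀ (Real.log R) - δ * u₀ (Real.log R)) hz
  have hz2 : ‖z ^ 2‖ ≤ ‖(0 : ℂ)‖ + 1 := by
    rw [norm_pow, norm_zero, zero_add]
    exact pow_le_one₀ (norm_nonneg _) hz1
  obtain ⟨h1, h2⟩ := hK _ hz2 u v huv (Real.log R) ⟨Real.log_le_log hr hrR.le, le_rfl⟩
  rw [sub_zero, norm_pow] at h1 h2
  rw [he]
  calc ‖v (Real.log R) - δ * u (Real.log R) - (v₀ (Real.log R) - δ * u₀ (Real.log R))‖
      = ‖(v (Real.log R) - v₀ (Real.log R)) - δ * (u (Real.log R) - u₀ (Real.log R))‖ := by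
        congr 1
        ring
    _ ≤ ‖v (Real.log R) - v₀ (Real.log R)‖ + |δ| * ‖u (Real.log R) - u₀ (Real.log R)‖ := by
        refine (norm_sub_le _ _).trans_eq ?_
        rw [norm_mul, Complex.norm_real, Real.norm_eq_abs]
    _ ≤ K * ‖z‖ ^ 2 + |δ| * (K * ‖z‖ ^ 2) := by gcongr
    _ = _ := by ring

theorem differentiable_crossEntire {r R : ℝ} (hr : 0 < r) (hrR : r < R) {ν δ : ℝ}
    {u₀ v₀ : ℝ → ℂ} (h₀ : IsShooting (Real.log r) ν δ 0 u₀ v₀) :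
    Differentiable ℂ (crossEntire r R ν δ (v₀ (Real.log R) - δ * u₀ (Real.log R))) := by
  set d := v₀ (Real.log R) - δ * u₀ (Real.log R)
  rw [← differentiableOn_univ, ← Complex.differentiableOn_compl_singleton_and_continuousAt_iff
    (c := 0) univ_mem]
  refine ⟨fun z hz => ?_, ?_⟩
  · have hz' : z ≠ 0 := hz.2
    have hev : crossEntire r R ν δ d =ᶠ[𝓝 z] fun z => crossLog r R ν δ (Complex.log z) := by
      filter_upwards [isOpen_ne.mem_nhds hz'] with w hw
      exact crossEntire_of_ne _ _ _ _ _ hw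
    exact ((differentiableAt_crossLog_log hr hrR ν δ hz').congr_of_eventuallyEq
      hev).differentiableWithinAt
  · obtain ⟨K, hK⟩ := exists_norm_crossEntire_sub_le hr hrR h₀
    have hlim : Tendsto (fun z : ℂ => K * ‖z‖ ^ 2) (𝓝 0) (𝓝 0) := by
      have : Continuous fun z : ℂ => K * ‖z‖ ^ 2 := by fun_prop
      simpa using this.tendsto 0
    rw [ContinuousAt, tendsto_iff_norm_sub_tendsto_zero, crossEntire_zero]
    refine squeeze_zero' (Eventually.of_forall fun z => norm_nonneg _) ?_ hlim
    filter_upwards [Metric.closedBall_mem_nhds (0 : ℂ) one_pos] with z hz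
    rcases eq_or_ne z 0 with rfl | hz0
    · simp [crossEntire_zero]
    · exact hK z hz0 (mem_closedBall_zero_iff.1 hz)

/-! ### Orders and zero count of `𝔥̃` in terms of the entire function. -/

theorem hTilde_eq_crossEntire {r R : ℝ} (hr : 0 < r) (hR : 0 < R) (ν δ : ℝ) (d : ℂ) {z : ℂ}
    (hz : z ≠ 0) : hTilde r R ν δ z =
      2 / (Real.pi * R * r) * (z ^ 2)⁻¹ * crossEntire r R ν δ d z := by
  rw [hTilde_eq_crossLog hr hR ν δ hz, crossEntire_of_ne _ _ _ _ _ hz]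

theorem hTilde_eventuallyEq {r R : ℝ} (hr : 0 < r) (hR : 0 < R) (ν δ : ℝ) (d z : ℂ) :
    hTilde r R ν δ =ᶠ[𝓝[≠] z]
      fun z => (2 / (Real.pi * R * r) * (z ^ 2)⁻¹) * crossEntire r R ν δ d z := by
  have h : ∀ᶠ w in 𝓝[≠] z, w ≠ 0 := by
    rcases eq_or_ne z 0 with rfl | hz
    · exact self_mem_nhdsWithin
    · exact nhdsWithin_le_nhds (isOpen_ne.mem_nhds hz)
  filter_upwards [h] with w hw
  exact hTilde_eq_crossEntire hr hR ν δ d hw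

section Order

variable {r R ν δ : ℝ} {d : ℂ}

theorem meromorphicAt_hTilde (hr : 0 < r) (hR : 0 < R)
    (hE : Differentiable ℂ (crossEntire r R ν δ d)) (z : ℂ) :
    MeromorphicAt (hTilde r R ν δ) z := by
  refine MeromorphicAt.congr ?_ (hTilde_eventuallyEq hr hR ν δ d z).symm
  have := (hE.analyticAt z).meromorphicAt
  fun_prop

theorem two_div_pi_mul_ne_zero (hr : 0 < r) (hR : 0 < R) :
    (2 / (Real.pi * R * r) : ℂ) ≠ 0 := by
  have h : (2 / (Real.pi * R * r) : ℝ) ≠ 0 := by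
    have := Real.pi_pos
    positivity
  exact_mod_cast h

theorem meromorphicOrderAt_hTilde_of_ne (hr : 0 < r) (hR : 0 < R)
    (hE : Differentiable ℂ (crossEntire r R ν δ d)) {z : ℂ} (hz : z ≠ 0) :
    meromorphicOrderAt (hTilde r R ν δ) z =
      (analyticOrderAt (crossEntire r R ν δ d) z).map (↑) := by
  rw [meromorphicOrderAt_congr (hTilde_eventuallyEq hr hR ν δ d z),
    ← (hE.analyticAt z).meromorphicOrderAt_eq]
  have hg : AnalyticAt ℂ (fun z : ℂ => 2 / (Real.pi * R * r : ℂ) * (z ^ 2)⁻¹) z := by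
    refine analyticAt_const.mul (AnalyticAt.inv (by fun_prop) (pow_ne_zero 2 hz))
  exact meromorphicOrderAt_mul_of_ne_zero hg
    (mul_ne_zero (two_div_pi_mul_ne_zero hr hR) (inv_ne_zero (pow_ne_zero 2 hz)))

theorem meromorphicOrderAt_hTilde_zero (hr : 0 < r) (hR : 0 < R)
    (hE : Differentiable ℂ (crossEntire r R ν δ d)) :
    meromorphicOrderAt (hTilde r R ν δ) 0 =
      -2 + (analyticOrderAt (crossEntire r R ν δ d) 0).map (↑) := by
  rw [meromorphicOrderAt_congr (hTilde_eventuallyEq hr hR ν δ d 0),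
    ← (hE.analyticAt 0).meromorphicOrderAt_eq]
  have h1 : MeromorphicAt (fun z : ℂ => 2 / (Real.pi * R * r : ℂ) * (z ^ 2)⁻¹) 0 := by fun_prop
  have h2 := meromorphicOrderAt_mul h1 (hE.analyticAt 0).meromorphicAt
  have h3 : meromorphicOrderAt (fun z : ℂ => 2 / (Real.pi * R * r : ℂ) * (z ^ 2)⁻¹) 0 =
      ((-2 : ℤ) : WithTop ℤ) := by
    rw [meromorphicOrderAt_eq_int_iff h1]
    refine ⟨fun _ => 2 / (Real.pi * R * r : ℂ), analyticAt_const, two_div_pi_mul_ne_zero hr hR, ?_⟩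
    filter_upwards with z
    rw [sub_zero, zpow_neg, smul_eq_mul, mul_comm]
    norm_cast
  rw [h3] at h2
  exact h2

theorem toNat_meromorphicOrderAt_hTilde (hr : 0 < r) (hR : 0 < R)
    (hE : Differentiable ℂ (crossEntire r R ν δ d)) {w : ℂ} (hw : crossEntire r R ν δ d w ≠ 0)
    {z : ℂ} (hz : z ≠ 0) :
    (meromorphicOrderAt (hTilde r R ν δ) z).untop₀.toNat =
      analyticOrderNatAt (crossEntire r R ν δ d) z := by
  rw [meromorphicOrderAt_hTilde_of_ne hr hR hE hz,
    ← Nat.cast_analyticOrderNatAt (analyticOrderAt_ne_top_of_entire hE hw z)]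
  rfl

/-- Away from `0` the two orders agree. At `0` a nonpositive order of `𝔥̃` contributes nothing, so
the order of `crossEntire` there is subtracted. -/
theorem hasZeroCount_hTilde (hr : 0 < r) (hR : 0 < R)
    (hE : Differentiable ℂ (crossEntire r R ν δ d)) {w : ℂ} (hw : crossEntire r R ν δ d w ≠ 0)
    (h0 : meromorphicOrderAt (hTilde r R ν δ) 0 ≤ 0) {ρ : ℝ} (hρ : 0 < ρ) {N : ℕ}
    (hN : zeroCount (crossEntire r R ν δ d) (Metric.ball 0 ρ) =
      analyticOrderNatAt (crossEntire r R ν δ d) 0 + N) :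
    HasZeroCount (hTilde r R ν δ) (Metric.ball 0 ρ) N := by
  classical
  have hfin : {z ∈ Metric.ball (0 : ℂ) ρ | crossEntire r R ν δ d z = 0}.Finite :=
    (finite_zeros_closedBall hE hw ρ).subset fun z hz => ⟨Metric.ball_subset_closedBall hz.1, hz.2⟩
  set S := hfin.toFinset
  have hS : ∀ z, z ∈ S ↔ z ∈ Metric.ball (0 : ℂ) ρ ∧ crossEntire r R ν δ d z = 0 := fun z =>
    Set.Finite.mem_toFinset hfin
  have hzero : (meromorphicOrderAt (hTilde r R ν δ) 0).untop₀.toNat = 0 := by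
    lift meromorphicOrderAt (hTilde r R ν δ) 0 to ℤ using ne_top_of_le_ne_top (by simp) h0 with k hk
    rw [WithTop.untop₀_coe]
    exact Int.toNat_of_nonpos (by exact_mod_cast h0)
  have hzS : ∀ z ∈ Metric.ball (0 : ℂ) ρ, (meromorphicOrderAt (hTilde r R ν δ) z).untop₀.toNat ≠ 0 →
      z ∈ S.erase 0 := by
    intro z hz h
    have hz0 : z ≠ 0 := by
      rintro rfl
      exact h hzero
    rw [toNat_meromorphicOrderAt_hTilde hr hR hE hw hz0] at h
    exact Finset.mem_erase.2 ⟨hz0, (hS z).2 ⟨hz, apply_eq_zero_of_analyticOrderNatAt_ne_zero h⟩⟩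
  constructor
  · refine (S.finite_toSet).subset fun z hz => ?_
    have hz0 : z ≠ 0 := by
      rintro rfl
      exact absurd hz.2 (not_lt.2 h0)
    have h := hz.2
    rw [meromorphicOrderAt_hTilde_of_ne hr hR hE hz0] at h
    refine (hS z).2 ⟨hz.1, apply_eq_zero_of_analyticOrderAt_ne_zero fun h' => ?_⟩
    rw [h'] at h
    exact lt_irrefl _ h
  · rw [finsum_mem_def, finsum_eq_sum_of_support_subset (s := S.erase 0)]
    · have h1 : zeroCount (crossEntire r R ν δ d) (Metric.ball 0 ρ) =
          analyticOrderNatAt (crossEntire r R ν δ d) 0 +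
            ∑ z ∈ S.erase 0, analyticOrderNatAt (crossEntire r R ν δ d) z := by
        rw [zeroCount_eq_sum (insert 0 (S.erase 0)), Finset.sum_insert (Finset.notMem_erase 0 S)]
        · intro z hz h
          rcases eq_or_ne z 0 with rfl | hz0
          · exact Finset.mem_insert_self _ _
          · exact Finset.mem_insert_of_mem (Finset.mem_erase.2 ⟨hz0, (hS z).2 ⟨hz, h⟩⟩)
        · intro z hz
          rcases Finset.mem_insert.1 hz with rfl | hz
          · exact Metric.mem_ball_self hρ
          · exact ((hS z).1 (Finset.mem_of_mem_erase hz)).1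
      rw [hN] at h1
      rw [Nat.add_left_cancel h1]
      refine Finset.sum_congr rfl fun z hz => ?_
      obtain ⟨hz0, hz⟩ := Finset.mem_erase.1 hz
      rw [Set.indicator_of_mem ((hS z).1 hz).1, toNat_meromorphicOrderAt_hTilde hr hR hE hw hz0]
    · intro z hz
      simp only [Function.mem_support, ne_eq, Set.indicator_apply_eq_zero, Classical.not_imp] at hz
      exact hzS z hz.1 hz.2

end Order

/-- The endpoint value lies between two positive multiples of `|z|²` near `0`. So `𝔥̃` is bounded
and bounded away from `0` there, which excludes a pole and a zero. -/
theorem meromorphicOrderAt_hTilde_zero_of_eq {r R : ℝ} (hr : 0 < r) (hrR : r < R) {ν δ : ℝ}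
    (hνδ : ν = |δ|) : meromorphicOrderAt (hTilde r R ν δ) 0 = 0 := by
  have hR : 0 < R := hr.trans hrR
  have h₀ := IsShooting.isShooting_exp (a := Real.log r) hνδ
  have hE := differentiable_crossEntire hr hrR h₀
  obtain ⟨K, hK⟩ := exists_norm_crossEntire_sub_le hr hrR h₀
  obtain ⟨c, hc, ρ, hρ, hlow⟩ := IsShooting.exists_lower_bound (Real.log_lt_log hr hrR) hνδ
  have hd : (fun x : ℝ => ((δ * Real.exp (δ * (x - Real.log r)) : ℝ) : ℂ)) (Real.log R)
      - δ * (fun x : ℝ => ((Real.exp (δ * (x - Real.log r)) : ℝ) : ℂ)) (Real.log R) = 0 := by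
    push_cast
    ring
  rw [hd] at hE hK
  have hmer := meromorphicAt_hTilde hr hR hE 0
  set κ : ℂ := 2 / (Real.pi * R * r)
  have hκ : 0 < ‖κ‖ := norm_pos_iff.2 (two_div_pi_mul_ne_zero hr hR)
  have hev : ∀ᶠ z in 𝓝[≠] (0 : ℂ), ‖κ‖ * c ≤ ‖hTilde r R ν δ z‖ ∧ ‖hTilde r R ν δ z‖ ≤ ‖κ‖ * K := by
    have hcont : Tendsto (fun z : ℂ => ‖z ^ 2‖) (𝓝[≠] 0) (𝓝 0) := by
      have h : Continuous fun z : ℂ => ‖z ^ 2‖ := by fun_prop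
      have := h.tendsto 0
      simp only [ne_eq, OfNat.ofNat_ne_zero, not_false_eq_true, zero_pow, norm_zero] at this
      exact this.mono_left nhdsWithin_le_nhds
    filter_upwards [self_mem_nhdsWithin, hcont.eventually (ge_mem_nhds hρ),
      nhdsWithin_le_nhds (Metric.closedBall_mem_nhds (0 : ℂ) one_pos)] with z hz hz2 hz1
    have hz0 : z ≠ 0 := hz
    have hpos : 0 < ‖z‖ ^ 2 := pow_pos (norm_pos_iff.2 hz0) 2
    obtain ⟨u, v, huv, he⟩ := exists_isShooting_crossEntire r R ν δ 0 hz0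
    have h1 := hlow _ hz2 u v huv
    have h2 := hK z hz0 (mem_closedBall_zero_iff.1 hz1)
    rw [sub_zero] at h2
    rw [← he, norm_pow] at h1
    rw [hTilde_eq_crossEntire hr hR ν δ 0 hz0, norm_mul, norm_mul, norm_inv, norm_pow, mul_assoc]
    constructor
    · gcongr
      rwa [inv_mul_eq_div, le_div_iff₀ hpos]
    · gcongr
      rwa [inv_mul_eq_div, div_le_iff₀ hpos]
  rcases lt_trichotomy (meromorphicOrderAt (hTilde r R ν δ) 0) 0 with h | h | h
  · have h1 := tendsto_norm_atTop_iff_cobounded.2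
      ((tendsto_cobounded_iff_meromorphicOrderAt_neg hmer).2 h)
    obtain ⟨z, hz1, hz2⟩ := ((h1.eventually_gt_atTop (‖κ‖ * K)).and hev).exists
    exact absurd hz2.2 (not_le.2 hz1)
  · exact h
  · have h1 := ((tendsto_zero_iff_meromorphicOrderAt_pos hmer).2 h).norm
    rw [norm_zero] at h1
    obtain ⟨z, hz1, hz2⟩ := ((h1.eventually_lt_const (mul_pos hκ hc)).and hev).exists
    exact absurd hz2.1 (not_le.2 hz1)

/-! ### Rouché's theorem on the circles, and the conclusion. -/

theorem exists_zeroCount_crossEntire {r R : ℝ} (hr : 0 < r) (hrR : r < R) (δ : ℝ) :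
    ∃ C : ℝ, 0 < C ∧ ∀ ν : ℝ, 0 ≤ ν → ∀ d : ℂ, Differentiable ℂ (crossEntire r R ν δ d) →
      ∀ s : ℕ, C * (ν ^ 3 + 1) < s →
        (∃ w, crossEntire r R ν δ d w ≠ 0) ∧
        zeroCount (crossEntire r R ν δ d) (Metric.ball 0 ((s + 1 / 2) * Real.pi / (R - r))) =
          2 * s + 2 := by
  have hR : 0 < R := hr.trans hrR
  have hL : 0 < R - r := sub_pos.2 hrR
  obtain ⟨C, hC, hasym⟩ := IsShooting.exists_asymptotic hr hrR δ
  -- Since `ν² + 1 ≤ 2(ν³ + 1)`, this makes the radius at least `C(ν² + 1)`; the summand `1` is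
  -- slack.
  refine ⟨2 * C * (R - r) + 1, by positivity, fun ν hν d hE s hs => ?_⟩
  have hν3 : 0 ≤ ν ^ 3 := pow_nonneg hν 3
  have hs1 : 1 ≤ s := by
    have h1 : (0 : ℝ) < s := lt_of_le_of_lt (by positivity) hs
    exact_mod_cast h1
  have hpi := Real.pi_gt_three
  set ρ : ℝ := (s + 1 / 2) * Real.pi / (R - r) with hρdef
  have hρ : 0 < ρ := by positivity
  have hρC : C * (ν ^ 2 + 1) ≤ ρ := by
    have h1 : ν ^ 2 + 1 ≤ 2 * (ν ^ 3 + 1) := by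
      nlinarith [mul_nonneg hν (sq_nonneg (ν - 1)), sq_nonneg (ν - 1)]
    rw [hρdef, le_div_iff₀ hL]
    calc C * (ν ^ 2 + 1) * (R - r) ≤ C * (2 * (ν ^ 3 + 1)) * (R - r) := by gcongr
      _ ≤ (2 * C * (R - r) + 1) * (ν ^ 3 + 1) := by linarith
      _ ≤ s := hs.le
      _ ≤ (s + 1 / 2) * Real.pi := by nlinarith
  set k : ℝ := Real.exp ((Real.log R - Real.log r) / 2)
  have hk : 0 < k := Real.exp_pos _
  have hkc : (k : ℂ) ≠ 0 := Complex.ofReal_ne_zero.2 hk.ne'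
  have hRc : (R : ℂ) ≠ 0 := Complex.ofReal_ne_zero.2 hR.ne'
  have hcoef : -(R : ℂ) / k ≠ 0 := div_ne_zero (neg_ne_zero.2 hRc) hkc
  have hmodel : Differentiable ℂ
      (fun z : ℂ => -(R : ℂ) / k * (z * Complex.sin (z * (R - r : ℝ)))) := by fun_prop
  have hclose : ∀ z ∈ Metric.sphere (0 : ℂ) ρ, ‖crossEntire r R ν δ d z -
      -(R : ℂ) / k * (z * Complex.sin (z * (R - r : ℝ)))‖ <
      ‖-(R : ℂ) / k * (z * Complex.sin (z * (R - r : ℝ)))‖ := by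
    intro z hz
    have hzn : ‖z‖ = ρ := mem_sphere_zero_iff_norm.1 hz
    have hz0 : z ≠ 0 := norm_pos_iff.1 (hzn ▸ hρ)
    obtain ⟨u, v, huv, he⟩ := exists_isShooting_crossEntire r R ν δ d hz0
    have h1 := hasym ν z (hzn ▸ hρC) u v huv
    rw [← he] at h1
    have h2 : Real.exp (|z.im| * (R - r)) / 8 ≤ ‖Complex.sin (z * (R - r : ℝ))‖ := by
      rw [← Complex.abs_im_mul_ofReal hL.le]
      refine Complex.exp_abs_im_div_le_norm_sin hs1 ?_
      rw [norm_mul, Complex.norm_real, Real.norm_eq_abs, abs_of_pos hL, hzn, hρdef]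
      field_simp
    have h3 : crossEntire r R ν δ d z - -(R : ℂ) / k * (z * Complex.sin (z * (R - r : ℝ))) =
        (k * crossEntire r R ν δ d z - -R * (z * Complex.sin (z * (R - r : ℝ)))) / k := by
      field_simp
    rw [h3, norm_div, norm_mul, norm_div, norm_neg, norm_mul, Complex.norm_real, Complex.norm_real,
      Real.norm_eq_abs, Real.norm_eq_abs, abs_of_pos hk, abs_of_pos hR, div_mul_eq_mul_div,
      div_lt_div_iff_of_pos_right hk]
    refine h1.trans_le ?_
    rw [← mul_assoc]
    gcongr
  constructor
  · refine ⟨ρ, fun h => ?_⟩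
    have := hclose ρ (by simp [abs_of_pos hρ])
    rw [h, zero_sub, norm_neg] at this
    exact lt_irrefl _ this
  · rw [zeroCount_eq_of_norm_sub_lt hmodel hE hρ hclose, zeroCount_mul_sin hcoef hL s]

end

theorem theorem3p1 (r R δ : ℝ) (hr : 0 < r) (hrR : r < R) :
    ∃ C : ℝ, 0 < C ∧ ∀ ν : ℝ, 0 ≤ ν →
      AnalyticOnNhd ℂ (hTilde r R ν δ) {0}ᶜ ∧ MeromorphicAt (hTilde r R ν δ) 0 ∧
      ∀ s : ℕ, C * (ν ^ 3 + 1) < s →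
        (ν ≠ |δ| → HasZeroCount (hTilde r R ν δ)
          (Metric.ball 0 ((s + 1 / 2) * Real.pi / (R - r))) (2 * s + 2)) ∧
        (ν = |δ| → HasZeroCount (hTilde r R ν δ)
          (Metric.ball 0 ((s + 1 / 2) * Real.pi / (R - r))) (2 * s)) := by
  have hR : 0 < R := hr.trans hrR
  have hL : 0 < R - r := sub_pos.2 hrR
  have hlog := Real.log_lt_log hr hrR
  obtain ⟨C, hC, hcount⟩ := exists_zeroCount_crossEntire hr hrR δ
  refine ⟨C, hC, fun ν hν => ⟨analyticOnNhd_hTilde hr hrR ν δ, ?_, fun s hs => ⟨?_, ?_⟩⟩⟩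
  · by_cases hνδ : ν = |δ|
    · exact meromorphicAt_hTilde hr hR
        (differentiable_crossEntire hr hrR (IsShooting.isShooting_exp hνδ)) 0
    · obtain ⟨u, v, huv, -⟩ := IsShooting.exists_isShooting_zero hlog hν hνδ
      exact meromorphicAt_hTilde hr hR (differentiable_crossEntire hr hrR huv) 0
  · intro hνδ
    obtain ⟨u, v, huv, hd⟩ := IsShooting.exists_isShooting_zero hlog hν hνδ
    have hE := differentiable_crossEntire hr hrR huv
    set d := v (Real.log R) - δ * u (Real.log R)
    obtain ⟨⟨w, hw⟩, hN⟩ := hcount ν hν d hE s hs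
    have hord : analyticOrderAt (crossEntire r R ν δ d) 0 = 0 :=
      (hE.analyticAt 0).analyticOrderAt_eq_zero.2 (by rwa [crossEntire_zero])
    refine hasZeroCount_hTilde hr hR hE hw ?_ (by positivity) ?_
    · rw [meromorphicOrderAt_hTilde_zero hr hR hE, hord]
      decide
    · rw [hN, analyticOrderNatAt, hord]
      simp
  · intro hνδ
    have hE := differentiable_crossEntire hr hrR (IsShooting.isShooting_exp hνδ)
    set d := (fun x : ℝ => ((δ * Real.exp (δ * (x - Real.log r)) : ℝ) : ℂ)) (Real.log R)
      - δ * (fun x : ℝ => ((Real.exp (δ * (x - Real.log r)) : ℝ) : ℂ)) (Real.log R)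
    obtain ⟨⟨w, hw⟩, hN⟩ := hcount ν hν d hE s hs
    have h0 := meromorphicOrderAt_hTilde_zero_of_eq hr hrR hνδ
    refine hasZeroCount_hTilde hr hR hE hw h0.le (by positivity) ?_
    rw [meromorphicOrderAt_hTilde_zero hr hR hE,
      ← Nat.cast_analyticOrderNatAt (analyticOrderAt_ne_top_of_entire hE hw 0)] at h0
    -- The entire function has a zero of order exactly `2` at `0`, which accounts for the two
    -- missing zeros.
    have h1 : (-2 : ℤ) + (analyticOrderNatAt (crossEntire r R ν δ d) 0 : ℤ) = 0 := by
      exact WithTop.coe_injective h0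
    rw [hN]
    omega
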